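/- Let $G=(V,E)$ be an infinite connected graph (parallel edges allowed, self-loops not allowed) of bounded degree, i.e. the number of edges at a vertex is bounded uniformly in the vertex. Let $d(x,y)$ be the graph distance and $B(v,R)=\{y\in V: d(v,y)\le R\}$. Assume that $G$ has strict polynomial growth: there are $0<D<\infty$ and $0<c_1\le C_1<\infty$ with $c_1R^D\le |B(v,R)|\le C_1R^D$ for all $v\in V$ and all $R\ge 1$. For a probability measure $\nu$ on $[0,\infty)$ let $(w(e))_{e\in E}$ be independent $\nu$-distributed edge weights, $T(\gamma)=\sum_{e\in\gamma}w(e)$ the passage time of a path $\gamma$, and $T(x,y)=\inf_{\gamma:x\to y}T(\gamma)$. A $T$-geodesic from $x$ to $y$ is a self-avoiding path $\pi:x\to y$ with $T(\pi)=T(x,y)$; fix an arbitrary well-ordering of the self-avoiding paths, and call the least $T$-geodesic from $x$ to $y$ the $T$-geodesic. For $p\in[0,1]$ let $G_p$ be the random subgraph in which every edge is kept independently with probability $p$, and put $$\underline{p_c}=\sup\Big\{p\in[0,1]:\limsup_{R\to\infty}\sup_{o\in V}\tfrac1R\log\mathbb P\big(G_p\text{ contains a path from }o\text{ to }V\setminus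 B(o,R)\big)<0\Big\},$$ and let $\vec{\underline{p_c}}$ be defined in the same way with "path" replaced by "path which is edge-geodesic in $G$". Let $a=\inf\operatorname{supp}\nu$. The measure $\nu$ is exponential-subcritical if either $a=0$ and $\nu(\{0\})<\underline{p_c}$, or $a>0$ and $\nu(\{a\})<\vec{\underline{p_c}}$. Theorem. Suppose that $\nu$ has finite mean and is exponential-subcritical. Then $\nu$ is absolutely continuous with respect to the expected empirical measure of the $T$-geodesic: for every Borel set $A\subset[0,\infty)$ with $\nu(A)>0$, $$\liminf_{d(x,y)\to\infty}\frac{\mathbb E\big[\#\{e\in\pi: w(e)\in A\}\big]}{d(x,y)}>0,$$ where $\pi$ is the $T$-geodesic from $x$ to $y$. Moreover, if $\nu$ strictly stochastically dominates a probability measure $\tilde\nu$ on $[0,\infty)$ with finite mean (that is, $\tilde\nu\neq\nu$ and there is a coupling $(\tilde w,w)$ of $\tilde\nu$ and $\nu$ with $\tilde w\le w$ almost surely), then $\mathbb E\tilde T\ll\mathbb E T$, that is, $$\liminf_{d(x,y)\to\infty}\frac{\mathbb E T(x,y)-\mathbb E\tilde T(x,y)}{d(x,y)}>0,$$ where $\tilde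 T$ denotes the passage times for independent $\tilde\nu$-distributed edge weights. -/

import Mathlib

open MeasureTheory ProbabilityTheory Filter Set
open scoped ENNReal NNReal unitInterval

/-- A multigraph without self-loops: a set `V` of vertices, a set `E` of edges, and a boundary map
sending every edge to an unordered pair of two distinct vertices. Parallel edges are allowed. -/
structure Multigraph (V E : Type*) where
  /-- the endpoints of an edge -/
  ends : E → Sym2 V
  /-- there are no self-loops -/
  loopless : ∀ e, ¬ (ends e).IsDiag

namespace Multigraph

variable {V E : Type*}

/-- Paths: alternating sequences of vertices and edges, from a first vertex to a last vertex. -/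
inductive Walk (G : Multigraph V E) : V → V → Type _
  | nil (x : V) : Walk G x x
  | cons {x y z : V} (e : E) (h : G.ends e = s(x, y)) (p : Walk G y z) : Walk G x z

namespace Walk

variable {G : Multigraph V E}

/-- The sequence of edges of a path. -/
def edges : {x y : V} → G.Walk x y → List E
  | _, _, nil _ => []
  | _, _, cons e _ p => e :: p.edges

/-- The sequence of vertices of a path. -/
def support : {x y : V} → G.Walk x y → List V
  | x, _, nil _ => [x]
  | x, _, cons _ _ p => x :: p.support

/-- The number of steps of a path. -/
def length {x y : V} (p : G.Walk x y) : ℕ := p.edges.length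

/-- The passage time of a path: the sum of the weights over its sequence of edges. -/
def time {x y : V} (p : G.Walk x y) (w : E → ℝ≥0) : ℝ≥0 := (p.edges.map w).sum

/-- No vertex is repeated. -/
def IsSelfAvoiding {x y : V} (p : G.Walk x y) : Prop := p.support.Nodup

end Walk

variable (G : Multigraph V E)

/-- Self-avoiding paths from `x` to `y`. -/
def SelfAvoidingPath (x y : V) : Type _ := {p : G.Walk x y // p.IsSelfAvoiding}

/-- Every two vertices are joined by a path. -/
def Connected : Prop := ∀ x y : V, Nonempty (G.Walk x y)

/-- The number of edges at a vertex (with multiplicity) is bounded uniformly in the vertex. -/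
def BoundedDegree : Prop := ∃ D : ℕ, ∀ v : V, {e : E | v ∈ G.ends e}.encard ≤ D

/-- The graph distance (meaningful when the graph is connected). -/
noncomputable def dist (x y : V) : ℕ := ⨅ p : G.Walk x y, p.length

/-- The closed ball `B(v, R)`, a set of vertices. -/
def ball (v : V) (R : ℝ) : Set V := {y | (G.dist v y : ℝ) ≤ R}

/-- Strict polynomial growth: `c₁ R ^ d ≤ |B(v, R)| ≤ C₁ R ^ d` for all vertices `v` and all
`R ≥ 1`. The lower bound forces the balls to be finite, so `Set.ncard` is their cardinality. -/
def StrictPolynomialGrowth : Prop :=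
  ∃ d c₁ C₁ : ℝ, 0 < d ∧ 0 < c₁ ∧ c₁ ≤ C₁ ∧ ∀ R : ℝ, 1 ≤ R → ∀ v : V,
    c₁ * R ^ d ≤ ((G.ball v R).ncard : ℝ) ∧ ((G.ball v R).ncard : ℝ) ≤ C₁ * R ^ d

/-- The filter on pairs of vertices expressing `d(x, y) → ∞`. -/
noncomputable def distAtTop : Filter (V × V) := comap (fun q : V × V => G.dist q.1 q.2) atTop

/-! ### Percolation thresholds -/

/-- The set of open edges contains a path from `o` to the complement of `B(o, R)`. -/
def EscapeEvent (o : V) (R : ℕ) : Set (Set E) :=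
  {S | ∃ (y : V) (p : G.Walk o y), y ∉ G.ball o R ∧ ∀ e ∈ p.edges, e ∈ S}

/-- The set of open edges contains a path from `o` to the complement of `B(o, R)` that is
edge-geodesic in `G`. -/
def GeodesicEscapeEvent (o : V) (R : ℕ) : Set (Set E) :=
  {S | ∃ (y : V) (p : G.Walk o y), y ∉ G.ball o R ∧ p.length = G.dist o y ∧ ∀ e ∈ p.edges, e ∈ S}

/-- `limsup_{R → ∞} sup_o (1 / R) log P(A(o, R)) < 0` for Bernoulli bond percolation of
parameter `p`, computed in the extended reals (so that `log 0 = -∞`). -/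
def UniformExponentialDecay (A : V → ℕ → Set (Set E)) (p : I) : Prop :=
  limsup (fun R : ℕ => ⨆ o : V, ENNReal.log (setBernoulli (univ : Set E) p (A o R)) / (R : EReal))
    atTop < 0

/-- The exponential percolation threshold. -/
noncomputable def expThreshold : ℝ :=
  sSup {t : ℝ | ∃ p : I, t = (p : ℝ) ∧ UniformExponentialDecay G.EscapeEvent p}

/-- The exponential geodesic percolation threshold. -/
noncomputable def expGeodesicThreshold : ℝ :=
  sSup {t : ℝ | ∃ p : I, t = (p : ℝ) ∧ UniformExponentialDecay G.GeodesicEscapeEvent p}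

/-- `ν` is exponential-subcritical for `G`; here `sInf ν.support` is the infimum of the support. -/
def ExponentialSubcritical (ν : Measure ℝ≥0) : Prop :=
  (sInf ν.support = 0 ∧ ν.real {0} < G.expThreshold) ∨
    (0 < sInf ν.support ∧ ν.real {sInf ν.support} < G.expGeodesicThreshold)

/-! ### First passage percolation -/

/-- The passage time `T(x, y)`. -/
noncomputable def passageTime (w : E → ℝ≥0) (x y : V) : ℝ≥0 := ⨅ p : G.Walk x y, p.time w

/-- The law of independent `ν`-distributed edge weights. -/
noncomputable def weightLaw (E : Type*) (ν : Measure ℝ≥0) [IsProbabilityMeasure ν] :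
    Measure (E → ℝ≥0) := Measure.infinitePi fun _ : E => ν

/-- The expected passage time `𝔼 T(x, y)` for the weight distribution `ν`. -/
noncomputable def expectedTime (ν : Measure ℝ≥0) [IsProbabilityMeasure ν] (x y : V) : ℝ :=
  ∫ w, (G.passageTime w x y : ℝ) ∂(weightLaw E ν)

/-- `p` is a (self-avoiding) `T`-geodesic from `x` to `y`. -/
def IsTGeodesic (w : E → ℝ≥0) {x y : V} (p : G.SelfAvoidingPath x y) : Prop :=
  p.1.time w = G.passageTime w x y

/-- The set of edges of *the* `T`-geodesic from `x` to `y`, that is, of the one which is least for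
the given well-ordering `r` of self-avoiding paths; it is empty if there is no `T`-geodesic. -/
def geodesicEdges (r : ∀ x y : V, G.SelfAvoidingPath x y → G.SelfAvoidingPath x y → Prop)
    (w : E → ℝ≥0) (x y : V) : Set E :=
  {e | ∃ p : G.SelfAvoidingPath x y, G.IsTGeodesic w p ∧
    (∀ p' : G.SelfAvoidingPath x y, G.IsTGeodesic w p' → ¬ r x y p' p) ∧ e ∈ p.1.edges}

/-- `ν` is absolutely continuous with respect to the expected empirical measure of the
`T`-geodesic, ties between geodesics being broken by the well-ordering `r`. -/
def AbsContExpectedEmpirical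
    (r : ∀ x y : V, G.SelfAvoidingPath x y → G.SelfAvoidingPath x y → Prop)
    (ν : Measure ℝ≥0) [IsProbabilityMeasure ν] : Prop :=
  ∀ A : Set ℝ≥0, MeasurableSet A → 0 < ν A →
    0 < liminf (fun q : V × V =>
      (∫⁻ w, ({e ∈ G.geodesicEdges r w q.1 q.2 | w e ∈ A}.encard : ℝ≥0∞) ∂(weightLaw E ν)) /
        (G.dist q.1 q.2 : ℝ≥0∞)) G.distAtTop

/-- The asymptotic strict inequality `𝔼 T' ≪ 𝔼 T`, for the weight distributions `ν'` and `ν`: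
`liminf_{d(x, y) → ∞} (𝔼 T(x, y) - 𝔼 T'(x, y)) / d(x, y) > 0`, the `liminf` being computed in the
extended reals. -/
def ExpectedTimeMuchLess (ν' ν : Measure ℝ≥0) [IsProbabilityMeasure ν'] [IsProbabilityMeasure ν] :
    Prop :=
  0 < liminf (fun q : V × V =>
    (((G.expectedTime ν q.1 q.2 - G.expectedTime ν' q.1 q.2) / (G.dist q.1 q.2 : ℝ) : ℝ) : EReal))
    G.distAtTop

end Multigraph

/-- `ν` has finite mean. -/
def HasFiniteMean (ν : Measure ℝ≥0) : Prop := ∫⁻ t, (t : ℝ≥0∞) ∂ν < ∞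

/-- `ν` strictly stochastically dominates `ν'`: they differ, and some coupling of `ν'` and `ν` is
carried by `{(s, t) | s ≤ t}`. -/
def StrictlyStochasticallyDominates (ν ν' : Measure ℝ≥0) : Prop :=
  ν' ≠ ν ∧ ∃ ρ : Measure (ℝ≥0 × ℝ≥0),
    ρ.map Prod.fst = ν' ∧ ρ.map Prod.snd = ν ∧ ∀ᵐ z ∂ρ, z.1 ≤ z.2

/-! Geodesics are forced to use weights in `A` by local surgery. Let `a` be the infimum of the
support and call a crossing of the ball of radius `R` around `o` fast if it takes less than `R (a +
δ)`. Suppose that `o` lies on the geodesic, at distance at least `R` from its endpoints, and has no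
fast crossing. Resample the edges near `o`: those inside the open ball get weights at most `a +
δ/2`, those leading to the sphere get weights in a part of `A` bounded by `M < R δ/2`. The route
through `o` is now strictly faster, so `T(x, y)` drops, whereas paths avoiding the open ball keep
their old times. Hence every new geodesic enters the ball, through an edge with weight in `A`
(`IsTGeodesic.exists_mem_edges_of_modification`). Resampling preserves the law, and the prescribed
weights have probability bounded below, so this costs a constant factor
(`measure_goodVisit_mul_le`).

That such visits are linearly many follows from a Peierls argument. Successive last exits turn a
path into a chain of well separated vertices (`Walk.exists_chain`). Local events at these vertices
are independent, and there are at most `K ^ N` chains of length `N`, with `K` a bound on the size of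
balls. If the bad events are rare compared with `K⁻²`, it is exponentially unlikely that half of
some chain is bad (`measure_exists_chain_le`). Polynomial growth makes `K` negligible against
exponential decay. The argument is run twice. First, bad means that light edges escape locally,
which subcriticality controls; every good step costs an additional amount, so fast crossings become
exponentially unlikely (`ExponentialSubcritical.exists_fastCrossing_decay`). Then bad means having a
fast crossing (`le_tsum_measure_goodVisit`).

All this is done for marks in a space `X` with weights `φ` of the marks. For the strict inequality
the marks are coupled pairs and `A` consists of the pairs differing by at least `η`: the geodesic of
the larger weights meets linearly many of them, and each saves `η` for the smaller weights. -/

namespace Multigraph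

variable {V E : Type*} {G : Multigraph V E}

/-! ### Paths: concatenation, passage times, exits, loop erasure -/

namespace Walk

/-- Concatenation of paths. -/
def append : {x y z : V} → G.Walk x y → G.Walk y z → G.Walk x z
  | _, _, _, nil _, q => q
  | _, _, _, cons e h p, q => cons e h (p.append q)

/-- The reversed path. -/
def reverse : {x y : V} → G.Walk x y → G.Walk y x
  | _, _, nil x => nil x
  | _, _, cons (x := x) e h p =>
      p.reverse.append (cons e (h.trans Sym2.eq_swap) (nil x))

@[simp] lemma edges_nil (x : V) : (nil x : G.Walk x x).edges = [] := rfl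

@[simp] lemma edges_cons {x y z : V} (e : E) (h : G.ends e = s(x, y)) (p : G.Walk y z) :
    (cons e h p).edges = e :: p.edges := rfl

@[simp] lemma support_nil (x : V) : (nil x : G.Walk x x).support = [x] := rfl

@[simp] lemma support_cons {x y z : V} (e : E) (h : G.ends e = s(x, y)) (p : G.Walk y z) :
    (cons e h p).support = x :: p.support := rfl

@[simp] lemma edges_append {x y z : V} (p : G.Walk x y) (q : G.Walk y z) :
    (p.append q).edges = p.edges ++ q.edges := by
  induction p with
  | nil => rfl
  | cons e h p ih => simp [append, ih]

@[simp] lemma edges_reverse {x y : V} (p : G.Walk x y) : p.reverse.edges = p.edges.reverse := by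
  induction p with
  | nil => rfl
  | cons e h p ih => simp [reverse, ih]

@[simp] lemma length_nil (x : V) : (nil x : G.Walk x x).length = 0 := rfl

@[simp] lemma length_cons {x y z : V} (e : E) (h : G.ends e = s(x, y)) (p : G.Walk y z) :
    (cons e h p).length = p.length + 1 := by simp [length]

@[simp] lemma length_append {x y z : V} (p : G.Walk x y) (q : G.Walk y z) :
    (p.append q).length = p.length + q.length := by simp [length]

@[simp] lemma length_reverse {x y : V} (p : G.Walk x y) : p.reverse.length = p.length := by
  simp [length]

@[simp] lemma time_nil (x : V) (w : E → ℝ≥0) : (nil x : G.Walk x x).time w = 0 := rfl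

@[simp] lemma time_cons {x y z : V} (e : E) (h : G.ends e = s(x, y)) (p : G.Walk y z)
    (w : E → ℝ≥0) : (cons e h p).time w = w e + p.time w := by simp [time]

@[simp] lemma time_append {x y z : V} (p : G.Walk x y) (q : G.Walk y z) (w : E → ℝ≥0) :
    (p.append q).time w = p.time w + q.time w := by simp [time]

@[simp] lemma time_reverse {x y : V} (p : G.Walk x y) (w : E → ℝ≥0) :
    p.reverse.time w = p.time w := by simp [time, List.sum_reverse]

lemma start_mem_support {x y : V} (p : G.Walk x y) : x ∈ p.support := by
  cases p <;> simp

lemma end_mem_support {x y : V} (p : G.Walk x y) : y ∈ p.support := by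
  induction p with
  | nil => simp
  | cons e h p ih => simp [ih]

lemma mem_support_of_mem_ends {x y : V} (p : G.Walk x y) {e : E} (he : e ∈ p.edges) {v : V}
    (hv : v ∈ G.ends e) : v ∈ p.support := by
  induction p with
  | nil => simp at he
  | cons e' h p ih =>
    simp only [edges_cons, List.mem_cons] at he
    rcases he with rfl | he
    · rw [h, Sym2.mem_iff] at hv
      rcases hv with rfl | rfl
      · simp
      · simp [start_mem_support]
    · simp [ih he]

lemma support_suffix_append {x y z : V} (p : G.Walk x y) (q : G.Walk y z) :
    q.support <:+ (p.append q).support := by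
  induction p with
  | nil => exact List.suffix_rfl
  | cons e h p ih => exact (ih q).trans (List.suffix_cons _ _)

/-- From a known vertex, an edge determines the next vertex. This reduces countability and
finiteness of sets of paths to lists of edges. -/
lemma edges_injective {x y : V} : Function.Injective (fun p : G.Walk x y => p.edges) := by
  intro p
  induction p with
  | nil x =>
    rintro q h
    cases q with
    | nil => rfl
    | cons => simp at h
  | cons e h p ih =>
    intro q hq
    cases q with
    | nil => simp at hq
    | cons e' h' q =>
      simp only [edges_cons, List.cons.injEq] at hq
      obtain ⟨rfl, hq⟩ := hq
      obtain rfl := Sym2.congr_right.1 (h.symm.trans h')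
      rw [ih hq]

lemma length_mul_le_time {x y : V} (p : G.Walk x y) (w : E → ℝ≥0) {a : ℝ≥0}
    (h : ∀ e, a ≤ w e) : p.length * a ≤ p.time w := by
  induction p with
  | nil => simp
  | cons e _ p ih =>
    simp only [length_cons, time_cons, Nat.cast_add, Nat.cast_one]
    calc (p.length + 1) * a = a + p.length * a := by ring
      _ ≤ _ := add_le_add (h e) ih

lemma time_congr {x y : V} (p : G.Walk x y) {w w' : E → ℝ≥0} (h : ∀ e ∈ p.edges, w e = w' e) :
    p.time w = p.time w' := by
  unfold time
  rw [List.map_congr_left h]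

lemma time_le_length_mul {x y : V} (p : G.Walk x y) (w : E → ℝ≥0) {b : ℝ≥0}
    (h : ∀ e ∈ p.edges, w e ≤ b) : p.time w ≤ p.length * b := by
  have := List.sum_le_card_nsmul (p.edges.map w) b (by simpa using h)
  simpa [time, length] using this

/-- First exit of a path from a set of vertices. -/
lemma exists_first_exit (Q : V → Prop) {x y : V} (p : G.Walk x y) (hx : Q x) (hy : ¬ Q y) :
    ∃ (u v : V) (q : G.Walk x u) (e : E) (h : G.ends e = s(u, v)) (q' : G.Walk v y),
      p = q.append (cons e h q') ∧ (∀ z ∈ q.support, Q z) ∧ ¬ Q v := by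
  induction p with
  | nil => exact absurd hx hy
  | @cons x m y e h p ih =>
    by_cases hm : Q m
    · obtain ⟨u, v, q, e', h', q', rfl, h1, h2⟩ := ih hm hy
      refine ⟨u, v, cons e h q, e', h', q', rfl, ?_, h2⟩
      simpa [hx] using h1
    · exact ⟨x, m, nil x, e, h, p, rfl, by simpa using hx, hm⟩

/-- Last exit of a path from a set of vertices. -/
lemma exists_last_exit (Q : V → Prop) {x y : V} (p : G.Walk x y) (hx : ∃ z ∈ p.support, Q z)
    (hy : ¬ Q y) :
    ∃ (u v : V) (q : G.Walk x u) (e : E) (h : G.ends e = s(u, v)) (q' : G.Walk v y),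
      p = q.append (cons e h q') ∧ Q u ∧ ∀ z ∈ q'.support, ¬ Q z := by
  induction p with
  | nil => simp only [support_nil, List.mem_singleton, exists_eq_left] at hx; exact absurd hx hy
  | @cons x m y e h p ih =>
    by_cases hm : ∃ z ∈ p.support, Q z
    · obtain ⟨u, v, q, e', h', q', rfl, h1, h2⟩ := ih hm hy
      exact ⟨u, v, cons e h q, e', h', q', rfl, h1, h2⟩
    · push Not at hm
      obtain ⟨z, hz, hQ⟩ := hx
      rw [support_cons, List.mem_cons] at hz
      rcases hz with rfl | hz
      · exact ⟨z, m, nil z, e, h, p, rfl, hQ, hm⟩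
      · exact absurd hQ (hm z hz)

lemma exists_append_of_mem_support {x y z : V} (p : G.Walk x y) (hz : z ∈ p.support) :
    ∃ (q : G.Walk x z) (q' : G.Walk z y), p = q.append q' := by
  induction p with
  | nil x => obtain rfl : z = x := by simpa using hz
             exact ⟨nil _, nil _, rfl⟩
  | cons e h p ih =>
    rw [support_cons, List.mem_cons] at hz
    rcases hz with rfl | hz
    · exact ⟨nil _, cons e h p, rfl⟩
    · obtain ⟨q, q', rfl⟩ := ih hz
      exact ⟨cons e h q, q', rfl⟩

/-- Loop erasure: if the first vertex is visited again, everything before that visit is dropped.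
Keeping a sublist of the edges ensures that the passage time does not increase. -/
lemma exists_selfAvoiding {x y : V} (p : G.Walk x y) :
    ∃ q : G.Walk x y, q.IsSelfAvoiding ∧ q.edges.Sublist p.edges := by
  induction p with
  | nil x => exact ⟨nil x, by simp [IsSelfAvoiding], by simp⟩
  | @cons x m y e h p ih =>
    obtain ⟨q, hq, hs⟩ := ih
    by_cases hx : x ∈ q.support
    · obtain ⟨q₁, q₂, rfl⟩ := q.exists_append_of_mem_support hx
      refine ⟨q₂, List.Nodup.sublist (support_suffix_append q₁ q₂).sublist hq, ?_⟩
      rw [edges_append] at hs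
      exact ((List.sublist_append_right _ _).trans hs).trans (List.sublist_cons_self _ _)
    · exact ⟨cons e h q, List.nodup_cons.2 ⟨hx, hq⟩, hs.cons_cons e⟩

lemma time_le_of_sublist {x y x' y' : V} (p : G.Walk x y) (q : G.Walk x' y')
    (h : q.edges.Sublist p.edges) (w : E → ℝ≥0) : q.time w ≤ p.time w :=
  (h.map w).sum_le_sum (by simp)

lemma IsSelfAvoiding.edges_nodup {x y : V} {p : G.Walk x y} (hp : p.IsSelfAvoiding) :
    p.edges.Nodup := by
  induction p with
  | nil => simp
  | cons e h p ih =>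
    have hp' := List.nodup_cons.1 hp
    refine List.nodup_cons.2 ⟨fun he => hp'.1 (p.mem_support_of_mem_ends he ?_), ih hp'.2⟩
    simp [h]

end Walk

/-! ### Graph distance and the edges near a vertex -/

section Dist

lemma dist_le_length {x y : V} (p : G.Walk x y) : G.dist x y ≤ p.length :=
  ciInf_le (OrderBot.bddBelow _) p

variable (hG : G.Connected)
include hG

lemma exists_walk_length_eq (x y : V) : ∃ p : G.Walk x y, p.length = G.dist x y := by
  have := hG x y
  exact Nat.sInf_mem (Set.range_nonempty _)

lemma dist_triangle (x y z : V) : G.dist x z ≤ G.dist x y + G.dist y z := by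
  obtain ⟨p, hp⟩ := exists_walk_length_eq hG x y
  obtain ⟨q, hq⟩ := exists_walk_length_eq hG y z
  rw [← hp, ← hq, ← Walk.length_append]
  exact dist_le_length _

lemma dist_comm (x y : V) : G.dist x y = G.dist y x := by
  have key : ∀ x y, G.dist x y ≤ G.dist y x := fun x y => by
    obtain ⟨p, hp⟩ := exists_walk_length_eq hG y x
    rw [← hp, ← Walk.length_reverse]
    exact dist_le_length _
  exact le_antisymm (key _ _) (key _ _)

end Dist

lemma dist_self (x : V) : G.dist x x = 0 :=
  Nat.le_zero.1 (dist_le_length (Walk.nil x))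

lemma dist_le_one {e : E} {u v : V} (h : G.ends e = s(u, v)) : G.dist u v ≤ 1 := by
  simpa using dist_le_length (Walk.cons e h (Walk.nil v))

lemma dist_le_succ (hG : G.Connected) {e : E} {u v : V} (h : G.ends e = s(u, v)) (o : V) :
    G.dist o v ≤ G.dist o u + 1 :=
  (dist_triangle hG o u v).trans (Nat.add_le_add_left (dist_le_one h) _)

/-- A path which leaves the open ball of radius `R` around its starting point has an initial segment
that ends at distance exactly `R` and stays in the ball before. -/
lemma Walk.exists_prefix_to_sphere (hG : G.Connected) {o y : V} (p : G.Walk o y) {R : ℕ}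
    (hR : 0 < R) (hy : R ≤ G.dist o y) :
    ∃ (u v : V) (q : G.Walk o u) (e : E) (h : G.ends e = s(u, v)) (q' : G.Walk v y),
      p = q.append (cons e h q') ∧ (∀ z ∈ q.support, G.dist o z < R) ∧ G.dist o v = R := by
  obtain ⟨u, v, q, e, h, q', h1, h2, h3⟩ := p.exists_first_exit (fun z => G.dist o z < R)
    (by simpa [dist_self] using hR) (by omega)
  refine ⟨u, v, q, e, h, q', h1, h2, ?_⟩
  have := h2 u q.end_mem_support
  have := dist_le_succ hG h o
  omega

/-- The edges with an endpoint at distance less than `R` from `o`. -/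
def nearEdges (G : Multigraph V E) (o : V) (R : ℕ) : Set E :=
  {e | ∃ v ∈ G.ends e, G.dist o v < R}

/-- A common edge would give a route from `o` to `o'` of length at most `(R - 1) + 1 + (R - 1)`.
This is the source of independence between well separated vertices. -/
lemma disjoint_nearEdges (hG : G.Connected) {o o' : V} {R : ℕ} (h : 2 * R ≤ G.dist o o') :
    Disjoint (G.nearEdges o R) (G.nearEdges o' R) := by
  rw [Set.disjoint_left]
  rintro e ⟨v, hv, hv'⟩ ⟨u, hu, hu'⟩
  have huv : G.dist v u ≤ 1 := by
    by_cases hvu : v = u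
    · subst hvu; simp [dist_self]
    · exact dist_le_one ((Sym2.mem_and_mem_iff hvu).1 ⟨hv, hu⟩)
  have h1 := dist_triangle hG o v o'
  have h2 := dist_triangle hG v u o'
  rw [dist_comm hG u o'] at h2
  omega

lemma Walk.edges_subset_nearEdges {o x y : V} {R : ℕ} (p : G.Walk x y)
    (h : ∀ z ∈ p.support, G.dist o z < R) : ∀ e ∈ p.edges, e ∈ G.nearEdges o R := by
  intro e he
  obtain ⟨v, hv⟩ : ∃ v, v ∈ G.ends e := ⟨_, Sym2.out_fst_mem _⟩
  exact ⟨v, hv, h v (p.mem_support_of_mem_ends he hv)⟩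

/-! ### Finiteness, countability and cardinality bounds from polynomial growth -/

section Growth

/-- `Set.ncard` vanishes on infinite sets, which the positive lower growth bound rules out. -/
lemma finite_closedBall (hgrowth : G.StrictPolynomialGrowth) (o : V) (R : ℕ) :
    {y | G.dist o y ≤ R}.Finite := by
  obtain ⟨d, c₁, C₁, hd, hc, -, h⟩ := hgrowth
  have h1 := (h (R + 1 : ℝ) (by simp) o).1
  have h2 : 0 < c₁ * (R + 1 : ℝ) ^ d := by positivity
  have h3 : (G.ball o (R + 1)).ncard ≠ 0 := by
    intro h0
    rw [h0] at h1
    simp only [Nat.cast_zero] at h1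
    linarith
  refine (Set.finite_of_ncard_ne_zero h3).subset fun y (hy : G.dist o y ≤ R) => ?_
  have : (G.dist o y : ℝ) ≤ R := by exact_mod_cast hy
  change (G.dist o y : ℝ) ≤ R + 1
  linarith

lemma exists_card_closedBall_le (hgrowth : G.StrictPolynomialGrowth) :
    ∃ (C : ℝ) (k : ℕ), 0 < C ∧ ∀ (R : ℕ), 1 ≤ R → ∀ o,
      ({y | G.dist o y ≤ R}.ncard : ℝ) ≤ C * (R : ℝ) ^ k := by
  obtain ⟨d, c₁, C₁, hd, hc, hC, h⟩ := hgrowth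
  refine ⟨C₁, ⌈d⌉₊, hc.trans_le hC, fun R hR o => ?_⟩
  have h1 := (h (R : ℝ) (by exact_mod_cast hR) o).2
  have : G.ball o (R : ℝ) = {y | G.dist o y ≤ R} := by
    ext y; simp [ball]
  rw [this] at h1
  refine h1.trans (mul_le_mul_of_nonneg_left ?_ (hc.le.trans hC))
  rw [← Real.rpow_natCast]
  exact Real.rpow_le_rpow_of_exponent_le (by exact_mod_cast hR) (Nat.le_ceil _)

lemma finite_incident (hdeg : G.BoundedDegree) (v : V) : {e | v ∈ G.ends e}.Finite := by
  obtain ⟨D, hD⟩ := hdeg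
  exact Set.finite_of_encard_le_coe (hD v)

lemma nearEdges_eq_biUnion (o : V) (R : ℕ) :
    G.nearEdges o R = ⋃ v ∈ {v | G.dist o v < R}, {e | v ∈ G.ends e} := by
  ext e
  simp only [nearEdges, Set.mem_ofPred_eq, Set.mem_iUnion, exists_prop]
  exact exists_congr fun v => and_comm

lemma finite_nearEdges (hdeg : G.BoundedDegree) (hgrowth : G.StrictPolynomialGrowth) (o : V)
    (R : ℕ) : (G.nearEdges o R).Finite := by
  rw [nearEdges_eq_biUnion]
  exact ((finite_closedBall hgrowth o R).subset fun v (hv : G.dist o v < R) => hv.le).biUnion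
    fun v _ => finite_incident hdeg v

lemma exists_ncard_closedBall_le (hgrowth : G.StrictPolynomialGrowth) (R : ℕ) :
    ∃ K : ℕ, 1 ≤ K ∧ ∀ o, {y | G.dist o y ≤ R}.ncard ≤ K := by
  obtain ⟨C, k, hC, h⟩ := exists_card_closedBall_le hgrowth
  -- Radius `R + 1` because the growth bound needs radius at least 1; the final `+ 1` makes `K`
  -- positive.
  refine ⟨⌈C * ((R + 1 : ℕ) : ℝ) ^ k⌉₊ + 1, by omega, fun o => ?_⟩
  have h1 := h (R + 1) (by omega) o
  have h2 : {y | G.dist o y ≤ R}.ncard ≤ {y | G.dist o y ≤ R + 1}.ncard :=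
    Set.ncard_le_ncard (fun y (hy : G.dist o y ≤ R) => hy.trans (Nat.le_succ _))
      (finite_closedBall hgrowth o (R + 1))
  have h3 : {y | G.dist o y ≤ R + 1}.ncard ≤ ⌈C * ((R + 1 : ℕ) : ℝ) ^ k⌉₊ := by
    exact_mod_cast h1.trans (Nat.le_ceil _)
  omega

lemma exists_ncard_nearEdges_le (hdeg : G.BoundedDegree) (hgrowth : G.StrictPolynomialGrowth)
    (R : ℕ) : ∃ m : ℕ, ∀ o, (G.nearEdges o R).ncard ≤ m := by
  obtain ⟨K, -, hK⟩ := exists_ncard_closedBall_le hgrowth R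
  obtain ⟨D, hD⟩ := id hdeg
  refine ⟨K * D, fun o => ?_⟩
  have hfin : {v | G.dist o v < R}.Finite :=
    (finite_closedBall hgrowth o R).subset fun v (hv : G.dist o v < R) => hv.le
  have h1 : (G.nearEdges o R).ncard ≤ ∑ v ∈ hfin.toFinset, {e | v ∈ G.ends e}.ncard := by
    have : G.nearEdges o R = ⋃ v ∈ hfin.toFinset, {e | v ∈ G.ends e} := by
      rw [nearEdges_eq_biUnion]; simp
    rw [this]
    exact Finset.set_ncard_biUnion_le _ _
  refine h1.trans ((Finset.sum_le_card_nsmul _ _ D fun v _ => ?_).trans ?_)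
  · have := hD v
    rw [(finite_incident hdeg v).encard_eq_coe_toFinset_card] at this
    rw [Set.ncard_eq_toFinset_card _ (finite_incident hdeg v)]
    exact_mod_cast this
  · rw [smul_eq_mul]
    refine Nat.mul_le_mul_right _ ?_
    rw [← Set.ncard_eq_toFinset_card _ hfin]
    exact (Set.ncard_le_ncard (fun v (hv : G.dist o v < R) => hv.le)
      (finite_closedBall hgrowth o R)).trans (hK o)

lemma countable_vertices (hgrowth : G.StrictPolynomialGrowth) :
    Countable V := by
  rcases isEmpty_or_nonempty V with h | ⟨⟨o⟩⟩
  · infer_instance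
  · rw [← Set.countable_univ_iff]
    refine (Set.countable_iUnion fun R : ℕ => (finite_closedBall hgrowth o R).countable).mono
      fun y _ => Set.mem_iUnion.2 ⟨G.dist o y, le_refl (G.dist o y)⟩

lemma countable_edges (hdeg : G.BoundedDegree)
    (hgrowth : G.StrictPolynomialGrowth) : Countable E := by
  have := countable_vertices hgrowth
  rw [← Set.countable_univ_iff]
  refine (Set.countable_iUnion fun v : V => (finite_incident hdeg v).countable).mono
    fun e _ => Set.mem_iUnion.2 ⟨_, Sym2.out_fst_mem _⟩

instance [Countable E] (x y : V) : Countable (G.Walk x y) :=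
  Walk.edges_injective.countable

instance [Countable E] (x y : V) : Countable (G.SelfAvoidingPath x y) :=
  inferInstanceAs (Countable {p : G.Walk x y // p.IsSelfAvoiding})

end Growth

end Multigraph

/-! ### Resampling coordinates of a product measure -/

section Resampling

variable {ι X : Type*} [MeasurableSpace X] {ρ : Measure X} [IsProbabilityMeasure ρ]

/-- The set `A` of configurations is determined by the coordinates in `S`. -/
def DeterminedBy (S : Set ι) (A : Set (ι → X)) : Prop :=
  ∀ ω ω' : ι → X, (∀ i ∈ S, ω i = ω' i) → ω ∈ A → ω' ∈ A

open Classical in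
/-- Resampling the coordinates in `S` preserves the law of independent coordinates. -/
lemma measurePreserving_piecewise (S : Set ι) :
    MeasurePreserving (fun z : (ι → X) × (ι → X) => S.piecewise z.2 z.1)
      ((Measure.infinitePi fun _ : ι => ρ).prod (Measure.infinitePi fun _ : ι => ρ))
      (Measure.infinitePi fun _ : ι => ρ) := by
  have hmeas : Measurable (fun z : (ι → X) × (ι → X) => S.piecewise z.2 z.1) := by
    refine measurable_pi_lambda _ fun i => ?_
    by_cases hi : i ∈ S
    · simp only [Set.piecewise_eq_of_mem _ _ _ hi]; fun_prop
    · simp only [Set.piecewise_eq_of_notMem _ _ _ hi]; fun_prop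
  refine ⟨hmeas, Measure.eq_infinitePi _ fun s t ht => ?_⟩
  rw [Measure.map_apply hmeas (MeasurableSet.pi s.countable_toSet fun i _ => ht i)]
  have : (fun z : (ι → X) × (ι → X) => S.piecewise z.2 z.1) ⁻¹' Set.pi s t =
      (Set.pi (s.filter (· ∉ S) : Finset ι) t) ×ˢ (Set.pi (s.filter (· ∈ S) : Finset ι) t) := by
    ext z
    simp only [Set.mem_preimage, Set.mem_pi, Finset.mem_coe, Set.mem_prod, Finset.mem_filter]
    constructor
    · refine fun h => ⟨fun i hi => ?_, fun i hi => ?_⟩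
      · simpa [Set.piecewise_eq_of_notMem _ _ _ hi.2] using h i hi.1
      · simpa [Set.piecewise_eq_of_mem _ _ _ hi.2] using h i hi.1
    · rintro ⟨h1, h2⟩ i hi
      by_cases hiS : i ∈ S
      · simpa [Set.piecewise_eq_of_mem _ _ _ hiS] using h2 i ⟨hi, hiS⟩
      · simpa [Set.piecewise_eq_of_notMem _ _ _ hiS] using h1 i ⟨hi, hiS⟩
  rw [this, Measure.prod_prod, Measure.infinitePi_pi _ fun i _ => ht i,
    Measure.infinitePi_pi _ fun i _ => ht i, mul_comm, Finset.prod_filter_mul_prod_filter_not]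

/-- Under the resampling map the coordinates in `S` come from the second copy and the others from
the first, so the preimage of `A ∩ B` is the rectangle `B ×ˢ A`. -/
lemma measure_inter_of_determinedBy {S : Set ι} {A B : Set (ι → X)} (hA : MeasurableSet A)
    (hB : MeasurableSet B) (hAS : DeterminedBy S A) (hBS : DeterminedBy Sᶜ B) :
    (Measure.infinitePi fun _ : ι => ρ) (A ∩ B) =
      (Measure.infinitePi fun _ : ι => ρ) A * (Measure.infinitePi fun _ : ι => ρ) B := by
  classical
  rw [← (measurePreserving_piecewise (ρ := ρ) S).measure_preimage (hA.inter hB).nullMeasurableSet,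
    mul_comm, ← Measure.prod_prod]
  congr 1
  ext z
  have h1 : ∀ i ∈ S, S.piecewise z.2 z.1 i = z.2 i := fun i hi => Set.piecewise_eq_of_mem _ _ _ hi
  have h2 : ∀ i ∈ Sᶜ, S.piecewise z.2 z.1 i = z.1 i := fun i hi =>
    Set.piecewise_eq_of_notMem _ _ _ hi
  constructor
  · exact fun h => ⟨hBS _ _ h2 h.2, hAS _ _ h1 h.1⟩
  · exact fun h => ⟨hAS _ _ (fun i hi => (h1 i hi).symm) h.2,
      hBS _ _ (fun i hi => (h2 i hi).symm) h.1⟩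

open Classical in
/-- If resampling a configuration of `H` in the finite set `S` of coordinates leads to `F` whenever
the new coordinates are in prescribed sets `Q i`, then `F` is at least as likely as `H` up to the
probability of the prescription. -/
lemma measure_mul_prod_le_of_resample {S : Set ι} (hS : S.Finite) {Q : ι → Set X}
    {H F : Set (ι → X)} (hQ : ∀ i, MeasurableSet (Q i))
    (hF : NullMeasurableSet F (Measure.infinitePi fun _ : ι => ρ))
    (h : ∀ ω ∈ H, ∀ ω' : ι → X, (∀ i ∈ S, ω' i ∈ Q i) → S.piecewise ω' ω ∈ F) :
    (Measure.infinitePi fun _ : ι => ρ) H * ∏ i ∈ hS.toFinset, ρ (Q i) ≤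
      (Measure.infinitePi fun _ : ι => ρ) F := by
  rw [← (measurePreserving_piecewise (ρ := ρ) S).measure_preimage hF,
    ← Measure.infinitePi_pi (μ := fun _ : ι => ρ) (fun i _ => hQ i), ← Measure.prod_prod]
  refine measure_mono ?_
  rintro ⟨ω, ω'⟩ ⟨h1, h2⟩
  exact h ω h1 ω' fun i hi => h2 i (by simpa using hi)

end Resampling

/-! ### Coarse graining into chains and the Peierls estimate -/

namespace Multigraph

variable {V E : Type*} {G : Multigraph V E}

/-- Sequences of `N` vertices starting at `x` with successive distances `L`, which can be continued
by one more step. -/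
def chains (G : Multigraph V E) (L : ℕ) : ℕ → V → Set (List V)
  | 0, _ => {[]}
  | N + 1, x => {l | ∃ z l', G.dist x z = L ∧ l' ∈ G.chains L N z ∧ l = x :: l'}

lemma length_of_mem_chains {L N : ℕ} {x : V} {l : List V} (hl : l ∈ G.chains L N x) :
    l.length = N := by
  induction N generalizing x l with
  | zero => rw [chains, Set.mem_singleton_iff] at hl; simp [hl]
  | succ N ih =>
    obtain ⟨z, l', -, hl', rfl⟩ := hl
    simp [ih hl']

lemma finite_chains_and_card_le (hgrowth : G.StrictPolynomialGrowth) {L K : ℕ}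
    (hK : ∀ o, {y | G.dist o y ≤ L}.ncard ≤ K) (N : ℕ) (x : V) :
    (G.chains L N x).Finite ∧ (G.chains L N x).ncard ≤ K ^ N := by
  classical
  induction N generalizing x with
  | zero => simp [chains]
  | succ N ih =>
    have hfin := finite_closedBall hgrowth x L
    have hsub : G.chains L (N + 1) x ⊆
        ⋃ z ∈ hfin.toFinset, (fun l => x :: l) '' G.chains L N z := by
      rintro _ ⟨z, l', hz, hl', rfl⟩
      simp only [Set.mem_iUnion]
      exact ⟨z, by simp [hz], l', hl', rfl⟩
    have hfin' : (⋃ z ∈ hfin.toFinset, (fun l => x :: l) '' G.chains L N z).Finite :=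
      hfin.toFinset.finite_toSet.biUnion fun z _ => (ih z).1.image _
    refine ⟨hfin'.subset hsub, (Set.ncard_le_ncard hsub hfin').trans ?_⟩
    refine (Finset.set_ncard_biUnion_le _ _).trans ?_
    refine (Finset.sum_le_card_nsmul _ _ (K ^ N) fun z _ =>
      (Set.ncard_image_le (ih z).1).trans (ih z).2).trans ?_
    rw [smul_eq_mul, pow_succ', ← Set.ncard_eq_toFinset_card _ hfin]
    exact Nat.mul_le_mul_right _ (hK x)

open Classical in
/-- Coarse graining of a path by successive last exits: the path visits the vertices of a chain
which are pairwise far apart, and its passage time is at least the sum of the costs of the steps. -/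
lemma Walk.exists_chain (hG : G.Connected) {L : ℕ} (hL : 0 < L) (w : E → ℝ≥0) (c δ : ℝ≥0)
    (bad : V → Prop)
    (hseg : ∀ (o z : V) (q : G.Walk o z), G.dist o z = L →
      c + (if bad o then 0 else δ) ≤ q.time w)
    (N : ℕ) {x y : V} (p : G.Walk x y) (hN : N * L ≤ G.dist x y) :
    ∃ l ∈ G.chains L N x, l.Pairwise (fun u v => L ≤ G.dist u v) ∧
      (∀ v ∈ l, v ∈ p.support ∧ L ≤ G.dist v y) ∧
      N * c + l.countP (fun o => ¬ bad o) * δ ≤ p.time w := by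
  induction N generalizing x with
  | zero => exact ⟨[], rfl, by simp, by simp, by simp⟩
  | succ N ih =>
    rw [Nat.succ_mul] at hN
    -- The last exit, not the first, is taken: the remaining path never comes back within `L` of
    -- `x`, so all later chain vertices are far from `x`.
    obtain ⟨u, v, q, e, h, q', rfl, hu, hq'⟩ := p.exists_last_exit (fun z => G.dist x z < L)
      ⟨x, p.start_mem_support, by simpa [dist_self] using hL⟩ (by omega)
    have hv : G.dist x v = L := by
      have := hq' v q'.start_mem_support
      have := dist_le_succ hG h x
      omega
    have hNv : N * L ≤ G.dist v y := by
      have := dist_triangle hG x v y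
      omega
    obtain ⟨l, hl, hl1, hl2, hl3⟩ := ih q' hNv
    refine ⟨x :: l, ⟨v, l, hv, hl, rfl⟩, ?_, ?_, ?_⟩
    · refine List.pairwise_cons.2 ⟨fun z hz => ?_, hl1⟩
      simpa using hq' z (hl2 z hz).1
    · intro z hz
      rcases List.mem_cons.1 hz with rfl | hz
      · exact ⟨Walk.start_mem_support _, by omega⟩
      · exact ⟨(Walk.support_suffix_append q _).subset
          (List.mem_cons_of_mem _ (hl2 z hz).1), (hl2 z hz).2⟩
    · have h1 := hseg x v (q.append (Walk.cons e h (Walk.nil v))) hv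
      rw [Walk.time_append, Walk.time_cons, Walk.time_nil, add_zero] at h1
      rw [Walk.time_append, Walk.time_cons, ← add_assoc]
      refine le_trans (le_of_eq ?_) (add_le_add h1 hl3)
      rw [List.countP_cons]
      by_cases hb : bad x <;> simp [hb] <;> ring

section Peierls

variable {X : Type*} [MeasurableSpace X] {ρ : Measure X} [IsProbabilityMeasure ρ]

open Classical in
lemma measurableSet_le_countP {Bad : V → Set (E → X)} (hmeas : ∀ o, MeasurableSet (Bad o))
    (l : List V) (m : ℕ) : MeasurableSet {ω | m ≤ l.countP (fun o => ω ∈ Bad o)} := by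
  have : Measurable fun ω : E → X => l.countP (fun o => ω ∈ Bad o) := by
    induction l with
    | nil => simp
    | cons x l ih =>
      simp only [List.countP_cons, decide_eq_true_eq]
      exact ih.add (Measurable.ite (hmeas x) measurable_const measurable_const)
  exact this measurableSet_Ici

open Classical in
-- Split according to whether the first vertex is bad. Its event is independent of the remaining
-- ones because the sets of near edges are disjoint; the two cases together produce the factor 2 per
-- vertex.
lemma measure_le_countP_le (hG : G.Connected) {R : ℕ} {Bad : V → Set (E → X)} {q : ℝ≥0∞}
    (hmeas : ∀ o, MeasurableSet (Bad o)) (hdet : ∀ o, DeterminedBy (G.nearEdges o R) (Bad o))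
    (hq : ∀ o, (Measure.infinitePi fun _ : E => ρ) (Bad o) ≤ q) (l : List V)
    (hl : l.Pairwise (fun u v => 2 * R ≤ G.dist u v)) (m : ℕ) :
    (Measure.infinitePi fun _ : E => ρ) {ω | m ≤ l.countP (fun o => ω ∈ Bad o)} ≤
      2 ^ l.length * q ^ m := by
  induction l generalizing m with
  | nil =>
    rcases m with _ | m
    · simp
    · simp
  | cons x l ih =>
    obtain ⟨hx, hl⟩ := List.pairwise_cons.1 hl
    rcases m with _ | m
    · simp only [zero_le, Set.ofPred_true, measure_univ, pow_zero, mul_one]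
      exact one_le_pow₀ (by norm_num)
    have hsub : {ω | m + 1 ≤ (x :: l).countP (fun o => ω ∈ Bad o)} ⊆
        (Bad x ∩ {ω | m ≤ l.countP (fun o => ω ∈ Bad o)}) ∪
          {ω | m + 1 ≤ l.countP (fun o => ω ∈ Bad o)} := by
      intro ω hω
      rw [Set.mem_ofPred_eq, List.countP_cons] at hω
      by_cases h : ω ∈ Bad x
      · left
        simp only [h, decide_true, if_true] at hω
        exact ⟨h, by simpa using hω⟩
      · right
        simpa [h] using hω
    have hdet' : DeterminedBy (G.nearEdges x R)ᶜ {ω | m ≤ l.countP (fun o => ω ∈ Bad o)} := by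
      intro ω ω' h hω
      refine le_trans (show m ≤ _ from hω) (List.countP_mono_left fun o ho hb => ?_)
      have hb' : ω ∈ Bad o := by simpa using hb
      simpa using hdet o ω ω' (fun e he => h e fun he' =>
        Set.disjoint_left.1 (disjoint_nearEdges hG (hx o ho)) he' he) hb'
    calc _ ≤ _ := measure_mono hsub
      _ ≤ _ := measure_union_le _ _
      _ = (Measure.infinitePi fun _ : E => ρ) (Bad x) * (Measure.infinitePi fun _ : E => ρ)
            {ω | m ≤ l.countP (fun o => ω ∈ Bad o)} + _ := by
          rw [measure_inter_of_determinedBy (hmeas x) (measurableSet_le_countP hmeas l m)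
            (hdet x) hdet']
      _ ≤ q * (2 ^ l.length * q ^ m) + 2 ^ l.length * q ^ (m + 1) := by
          gcongr
          · exact hq x
          · exact ih hl m
          · exact ih hl (m + 1)
      _ = 2 ^ (x :: l).length * q ^ (m + 1) := by rw [List.length_cons]; ring

open Classical in
/-- Peierls estimate: it is exponentially unlikely that some well separated chain started at `x`
has at least half of its vertices bad. -/
lemma measure_exists_chain_le (hG : G.Connected) (hgrowth : G.StrictPolynomialGrowth) {R K : ℕ}
    (hK : ∀ o, {y | G.dist o y ≤ 2 * R}.ncard ≤ K) {Bad : V → Set (E → X)} {q : ℝ≥0∞}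
    (hmeas : ∀ o, MeasurableSet (Bad o)) (hdet : ∀ o, DeterminedBy (G.nearEdges o R) (Bad o))
    (hq : ∀ o, (Measure.infinitePi fun _ : E => ρ) (Bad o) ≤ q)
    (hqK : 16 * (K : ℝ≥0∞) ^ 2 * q ≤ 1) (N : ℕ) (x : V) :
    (Measure.infinitePi fun _ : E => ρ) {ω | ∃ l ∈ G.chains (2 * R) N x,
      l.Pairwise (fun u v => 2 * R ≤ G.dist u v) ∧ N ≤ 2 * l.countP (fun o => ω ∈ Bad o)} ≤
      2⁻¹ ^ N := by
  obtain ⟨hfin, hcard⟩ := finite_chains_and_card_le hgrowth hK N x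
  set m := (N + 1) / 2 with hm
  set s := hfin.toFinset.filter (fun l => l.Pairwise (fun u v => 2 * R ≤ G.dist u v)) with hs
  have hsub : {ω | ∃ l ∈ G.chains (2 * R) N x,
      l.Pairwise (fun u v => 2 * R ≤ G.dist u v) ∧ N ≤ 2 * l.countP (fun o => ω ∈ Bad o)} ⊆
      ⋃ l ∈ s, {ω | m ≤ l.countP (fun o => ω ∈ Bad o)} := by
    rintro ω ⟨l, hl, hl1, hl2⟩
    simp only [Set.mem_iUnion]
    refine ⟨l, by simp [hs, hl, hl1], ?_⟩
    rw [Set.mem_ofPred_eq]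
    omega
  refine (measure_mono hsub).trans ((measure_biUnion_finset_le _ _).trans ?_)
  have hbound : ∀ l ∈ s, (Measure.infinitePi fun _ : E => ρ)
      {ω | m ≤ l.countP (fun o => ω ∈ Bad o)} ≤ 2 ^ N * q ^ m := by
    intro l hl
    rw [hs, Finset.mem_filter, Set.Finite.mem_toFinset] at hl
    have := measure_le_countP_le hG hmeas hdet hq l hl.2 m
    rwa [length_of_mem_chains hl.1] at this
  refine (Finset.sum_le_card_nsmul _ _ _ hbound).trans ?_
  have hcard' : (s.card : ℝ≥0∞) ≤ (K : ℝ≥0∞) ^ N := by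
    have h1 : s.card ≤ K ^ N :=
      (Finset.card_filter_le _ _).trans (by rwa [← Set.ncard_eq_toFinset_card _ hfin])
    exact_mod_cast h1
  -- With `m = ⌈N/2⌉`, the factors `K ^ N` (chains), `2 ^ N` (bad subsets) and another `2 ^ N` for
  -- the claimed decay are all absorbed by `q ^ m`. Raising the exponent from `N` to `2 * m` needs
  -- `1 ≤ 4 * K`, so `K = 0` is treated apart.
  have hfinal : (4 * (K : ℝ≥0∞)) ^ (2 * m) * q ^ m ≤ 1 := by
    rw [pow_mul, ← mul_pow]
    refine pow_le_one₀ zero_le ?_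
    calc _ = 16 * (K : ℝ≥0∞) ^ 2 * q := by ring
      _ ≤ 1 := hqK
  rcases Nat.eq_zero_or_pos K with rfl | hKpos
  · rcases Nat.eq_zero_or_pos N with rfl | hN
    · have : m = 0 := by omega
      simpa [this] using hcard'
    · have : s.card = 0 := by
        have := hcard'
        rw [Nat.cast_zero, zero_pow hN.ne'] at this
        exact_mod_cast le_antisymm this zero_le
      simp [this]
  · have hK1 : (1 : ℝ≥0∞) ≤ 4 * K := by
      have : (1 : ℝ≥0∞) ≤ K := by exact_mod_cast hKpos
      calc (1 : ℝ≥0∞) ≤ 1 * 1 := by simp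
        _ ≤ 4 * K := by gcongr; norm_num
    rw [nsmul_eq_mul]
    calc (s.card : ℝ≥0∞) * (2 ^ N * q ^ m) ≤ K ^ N * (2 ^ N * q ^ m) := by gcongr
      _ = 2⁻¹ ^ N * ((4 * K) ^ N * q ^ m) := by
          rw [mul_pow 4, show (4 : ℝ≥0∞) = 2 * 2 by norm_num, mul_pow 2 2]
          have : (2⁻¹ : ℝ≥0∞) ^ N * 2 ^ N = 1 := by
            rw [← mul_pow, ENNReal.inv_mul_cancel (by simp) (by simp), one_pow]
          calc _ = (1 : ℝ≥0∞) * (2 ^ N * K ^ N * q ^ m) := by ring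
            _ = (2⁻¹ ^ N * 2 ^ N) * (2 ^ N * K ^ N * q ^ m) := by rw [this]
            _ = _ := by ring
      _ ≤ 2⁻¹ ^ N * ((4 * K) ^ (2 * m) * q ^ m) := by
          gcongr
          omega
      _ ≤ 2⁻¹ ^ N * 1 := by gcongr
      _ = 2⁻¹ ^ N := mul_one _

end Peierls

end Multigraph

/-! ### Comparison with Bernoulli percolation -/

section Coupling

variable {ι X : Type*} [MeasurableSpace X]

/-- The random set of the coordinates with value in `B`, for independent coordinates. -/
lemma map_setOf_mem_infinitePi {ρ : Measure X} [IsProbabilityMeasure ρ] {B : Set X}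
    (hB : MeasurableSet B) (p : I) (hp : ρ B = ENNReal.ofReal p) :
    (Measure.infinitePi fun _ : ι => ρ).map (fun ω => {i | ω i ∈ B}) =
      setBernoulli (univ : Set ι) p := by
  have hB' : Measurable (fun x => x ∈ B) := measurable_mem.2 hB
  have hc : ∀ q : I, (unitInterval.toNNReal q : ℝ≥0∞) = ENNReal.ofReal q := fun q => by
    rw [ENNReal.ofReal, Real.toNNReal_of_nonneg q.2.1]; rfl
  have hlaw : ρ.map (fun x => x ∈ B) = unitInterval.toNNReal p • Measure.dirac True +
      unitInterval.toNNReal (σ p) • Measure.dirac False := by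
    refine Measure.ext_of_singleton fun P => ?_
    rw [Measure.map_apply hB' (measurableSet_singleton _)]
    by_cases hP : P
    · have : (fun x => x ∈ B) ⁻¹' {P} = B := by ext x; simp [hP]
      rw [this, hp]
      simp [hP, ENNReal.smul_def, hc]
    · have : (fun x => x ∈ B) ⁻¹' {P} = Bᶜ := by ext x; simp [hP]
      rw [this, prob_compl_eq_one_sub hB, hp, ← ENNReal.ofReal_one, ← ENNReal.ofReal_sub _ p.2.1]
      simp [hP, ENNReal.smul_def, hc]
  have hset : Measurable (fun P : ι → Prop => {i | P i}) :=
    MeasurableEquiv.setOfPred.measurable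
  have h1 : Measurable (fun (ω : ι → X) (i : ι) => ω i ∈ B) :=
    measurable_pi_lambda _ fun i => hB'.comp (measurable_pi_apply i)
  rw [setBernoulli_eq_map]
  simp only [Set.mem_univ]
  rw [← hlaw, ← Measure.infinitePi_map_pi (fun _ => ρ) (fun _ => hB'), Measure.map_map hset h1]
  rfl

/-- Monotone coupling: an increasing event is more likely for percolation with larger parameter. -/
lemma measure_setOf_mem_le_setBernoulli {ρ : Measure X} [IsProbabilityMeasure ρ] {B : Set X}
    (hB : MeasurableSet B) (p : I) (hp : ρ B ≤ ENNReal.ofReal p) {A : Set (Set ι)}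
    (hA : IsUpperSet A) (hmeas : MeasurableSet {ω : ι → X | {i | ω i ∈ B} ∈ A}) :
    (Measure.infinitePi fun _ : ι => ρ) {ω | {i | ω i ∈ B} ∈ A} ≤
      setBernoulli (univ : Set ι) p A := by
  set r : ℝ := ρ.real B with hr
  have hr0 : 0 ≤ r := measureReal_nonneg
  have hrp : r ≤ p := by
    rw [hr, measureReal_def]
    exact ENNReal.toReal_le_of_le_ofReal p.2.1 hp
  have hp1 := p.2.2
  have ht0 : 0 ≤ (1 - (p : ℝ)) / (1 - r) := div_nonneg (by linarith) (by linarith)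
  have ht1 : (1 - (p : ℝ)) / (1 - r) ≤ 1 := div_le_one_of_le₀ (by linarith) (by linarith)
  -- An auxiliary uniform variable opens each edge outside `B` with probability `1 - t`, and `1 - (1
  -- - r) t = p`. If `r = 1` then `p = 1`, and the convention for division by zero gives `t = 0`.
  set t : I := ⟨(1 - (p : ℝ)) / (1 - r), ht0, ht1⟩ with ht
  set B' : Set (X × I) := (Bᶜ ×ˢ Iio t)ᶜ with hB'
  have hB'm : MeasurableSet B' := (hB.compl.prod measurableSet_Iio).compl
  have hprob : (ρ.prod (volume : Measure I)) B' = ENNReal.ofReal p := by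
    rw [hB', prob_compl_eq_one_sub (hB.compl.prod measurableSet_Iio), Measure.prod_prod,
      unitInterval.volume_Iio, prob_compl_eq_one_sub hB]
    have h1 : ρ B = ENNReal.ofReal r := by rw [hr, ofReal_measureReal]
    rw [h1, ← ENNReal.ofReal_one, ← ENNReal.ofReal_sub _ hr0, ← ENNReal.ofReal_mul (by linarith),
      ← ENNReal.ofReal_sub _ (mul_nonneg (by linarith) ht0)]
    congr 1
    rcases eq_or_ne r 1 with h | h
    · rw [h]; linarith
    · have : (1 - r) ≠ 0 := sub_ne_zero.2 (Ne.symm h)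
      field_simp
      ring
  have hmap : (Measure.infinitePi fun _ : ι => ρ.prod (volume : Measure I)).map
      (fun ω i => (ω i).1) = Measure.infinitePi fun _ : ι => ρ := by
    rw [Measure.infinitePi_map_pi (fun _ => ρ.prod (volume : Measure I))
      (fun _ => measurable_fst), ← Measure.fst, Measure.fst_prod]
  have hfst : Measurable (fun (ω : ι → X × I) i => (ω i).1) := by fun_prop
  rw [← map_setOf_mem_infinitePi hB'm p hprob, ← hmap, Measure.map_apply hfst hmeas]
  -- `A` itself is not assumed measurable, so only this inequality for the image measure is used.
  refine le_trans (measure_mono fun ω hω => ?_) (Measure.le_map_apply ?_ _)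
  · refine hA (fun i hi => ?_) hω
    exact fun h => h.1 hi
  · refine Measurable.aemeasurable ?_
    have h1 : Measurable (fun (ω : ι → X × I) (i : ι) => ω i ∈ B') :=
      measurable_pi_lambda _ fun i => (measurable_mem.2 hB'm).comp (measurable_pi_apply i)
    exact (MeasurableEquiv.setOfPred.measurable).comp h1

end Coupling

/-! ### Mass near the infimum of the support -/

section Support

lemma ae_sInf_support_le (ν : Measure ℝ≥0) : ∀ᵐ t ∂ν, sInf ν.support ≤ t := by
  filter_upwards [ν.support_mem_ae] with t ht
  exact csInf_le (OrderBot.bddBelow _) ht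

lemma measure_Iic_sInf_support_add_pos (ν : Measure ℝ≥0) [IsProbabilityMeasure ν] {ε : ℝ≥0}
    (hε : 0 < ε) : 0 < ν (Iic (sInf ν.support + ε)) := by
  have hne : ν.support.Nonempty := by
    obtain ⟨x, -, hx⟩ := ν.nonempty_inter_support_of_pos (s := univ) (by simp)
    exact ⟨x, hx⟩
  have h := ν.isClosed_support.csInf_mem hne (OrderBot.bddBelow _)
  exact (Measure.mem_support_iff_forall _).1 h _ (Iic_mem_nhds (by simpa using hε))

/-- No mass lies below the infimum `a`, so the mass of `[0, a + ε]` tends to that of `{a}` as `ε →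
0`. Thus the light edges, not only those of minimal weight, can be dominated by percolation with
parameter `p`. -/
lemma exists_measure_Iic_lt {ν : Measure ℝ≥0} [IsProbabilityMeasure ν] {p : ℝ}
    (h : ν.real {sInf ν.support} < p) :
    ∃ ε : ℝ≥0, 0 < ε ∧ ν (Iic (sInf ν.support + ε)) ≤ ENNReal.ofReal p := by
  set a := sInf ν.support
  have h1 : ν (Iic a) < ENNReal.ofReal p := by
    have : ν (Iic a) = ν {a} := measure_congr <| by
      filter_upwards [ae_sInf_support_le ν] with t ht
      exact propext ⟨fun h => le_antisymm h ht, fun h => le_of_eq h⟩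
    rw [this, ← ofReal_measureReal]
    exact (ENNReal.ofReal_lt_ofReal_iff_of_nonneg measureReal_nonneg).2 h
  have h2 : Tendsto (fun n : ℕ => ν (Iic (a + 1 / ((n : ℝ≥0) + 1)))) atTop (nhds (ν (Iic a))) := by
    have : (⋂ n : ℕ, Iic (a + 1 / ((n : ℝ≥0) + 1))) = Iic a := by
      ext t
      simp only [Set.mem_iInter, Set.mem_Iic]
      refine ⟨fun ht => ?_, fun ht n => ht.trans (by simp)⟩
      have hlim : Tendsto (fun n : ℕ => a + 1 / ((n : ℝ≥0) + 1)) atTop (nhds (a + 0)) :=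
        tendsto_const_nhds.add tendsto_one_div_add_atTop_nhds_zero_nat
      simpa using ge_of_tendsto' hlim ht
    rw [← this]
    refine tendsto_measure_iInter_atTop (fun n => measurableSet_Iic.nullMeasurableSet) ?_
      ⟨0, measure_ne_top _ _⟩
    intro m n hmn
    refine Iic_subset_Iic.2 ?_
    gcongr
  obtain ⟨n, hn⟩ := (h2.eventually_lt_const h1).exists
  exact ⟨1 / ((n : ℝ≥0) + 1), by positivity, hn.le⟩

end Support

/-! ### Exponential decay against polynomial growth -/

namespace Multigraph

variable {V E : Type*} {G : Multigraph V E}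

lemma UniformExponentialDecay.exists_le_pow {A : V → ℕ → Set (Set E)} {p : I}
    (h : UniformExponentialDecay A p) :
    ∃ θ : ℝ, 0 < θ ∧ θ < 1 ∧ ∀ᶠ R : ℕ in atTop, ∀ o,
      setBernoulli (univ : Set E) p (A o R) ≤ ENNReal.ofReal (θ ^ R) := by
  obtain ⟨c, hc, hc0⟩ := EReal.lt_iff_exists_real_btwn.1 h
  have hc0' : c < 0 := by exact_mod_cast hc0
  refine ⟨Real.exp c, Real.exp_pos c, by simpa using hc0', ?_⟩
  filter_upwards [eventually_lt_of_limsup_lt hc, eventually_gt_atTop 0] with R hR hR0 o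
  have h1 := (le_iSup (fun o => ENNReal.log (setBernoulli (univ : Set E) p (A o R)) /
    (R : EReal)) o).trans hR.le
  rw [EReal.div_le_iff_le_mul (by exact_mod_cast hR0) (EReal.natCast_ne_top R)] at h1
  rw [← Real.exp_nat_mul, ← EReal.exp_coe, ← ENNReal.exp_log (setBernoulli _ _ _)]
  refine EReal.exp_monotone (h1.trans (le_of_eq ?_))
  simp

/-- Exponential decay beats polynomial growth. -/
lemma eventually_exists_peierls_bound (hgrowth : G.StrictPolynomialGrowth) {θ : ℝ} (h0 : 0 < θ)
    (h1 : θ < 1) (B : ℝ) (hB : 0 ≤ B) :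
    ∀ᶠ R : ℕ in atTop, ∃ K : ℕ, (∀ o, {y | G.dist o y ≤ 2 * R}.ncard ≤ K) ∧
      16 * (K : ℝ≥0∞) ^ 2 * ENNReal.ofReal (B * θ ^ R) ≤ 1 := by
  obtain ⟨C, k, hC, hcard⟩ := exists_card_closedBall_le hgrowth
  have hlim : Tendsto (fun n : ℕ => 16 * C ^ 2 * 2 ^ (2 * k) * B * ((n : ℝ) ^ (2 * k) * θ ^ n))
      atTop (nhds (16 * C ^ 2 * 2 ^ (2 * k) * B * 0)) :=
    (tendsto_pow_const_mul_const_pow_of_abs_lt_one (2 * k)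
      (by rwa [abs_of_pos h0])).const_mul _
  rw [mul_zero] at hlim
  filter_upwards [hlim.eventually_lt_const one_pos, eventually_ge_atTop 1] with R hR hR1
  refine ⟨⌊C * ((2 * R : ℕ) : ℝ) ^ k⌋₊, fun o => Nat.le_floor (hcard (2 * R) (by omega) o), ?_⟩
  have hK : (⌊C * ((2 * R : ℕ) : ℝ) ^ k⌋₊ : ℝ) ≤ C * (2 * R) ^ k := by
    have := Nat.floor_le (a := C * ((2 * R : ℕ) : ℝ) ^ k) (by positivity)
    push_cast at this ⊢
    exact this
  set K := ⌊C * ((2 * R : ℕ) : ℝ) ^ k⌋₊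
  have hle : (16 : ℝ) * K ^ 2 * (B * θ ^ R) ≤ 1 := by
    calc (16 : ℝ) * K ^ 2 * (B * θ ^ R) ≤ 16 * (C * (2 * R) ^ k) ^ 2 * (B * θ ^ R) := by gcongr
      _ = 16 * C ^ 2 * 2 ^ (2 * k) * B * ((R : ℝ) ^ (2 * k) * θ ^ R) := by
        rw [mul_pow 2, mul_pow, mul_pow]; ring
      _ ≤ 1 := hR.le
  have hK' : 16 * (K : ℝ≥0∞) ^ 2 = ENNReal.ofReal (16 * K ^ 2) := by
    rw [ENNReal.ofReal_mul (by norm_num), ENNReal.ofReal_pow (by positivity),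
      ENNReal.ofReal_natCast]
    norm_num
  rw [hK', ← ENNReal.ofReal_mul (by positivity), ← ENNReal.ofReal_one]
  exact ENNReal.ofReal_le_ofReal hle

end Multigraph

/-! ### Light escapes and the rarity of fast crossings -/

namespace Multigraph

variable {V E : Type*} {G : Multigraph V E}

/-- The set of open edges contains a path (of length `r` if `geo` holds) from `o` to the sphere of
radius `r`, all of whose edges are near `o`. -/
def LocalEscape (G : Multigraph V E) (geo : Prop) (o : V) (r : ℕ) : Set (Set E) :=
  {S | ∃ (z : V) (p : G.Walk o z), G.dist o z = r ∧ (geo → p.length = r) ∧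
    ∀ e ∈ p.edges, e ∈ S ∧ e ∈ G.nearEdges o r}

lemma isUpperSet_localEscape (geo : Prop) (o : V) (r : ℕ) :
    IsUpperSet (G.LocalEscape geo o r) := by
  rintro S T hST ⟨z, p, hz, hgeo, hp⟩
  exact ⟨z, p, hz, hgeo, fun e he => ⟨hST (hp e he).1, (hp e he).2⟩⟩

lemma localEscape_subset_escapeEvent (geo : Prop) (o : V) (k : ℕ) :
    G.LocalEscape geo o (k + 1) ⊆ G.EscapeEvent o k := by
  rintro S ⟨z, p, hz, -, hp⟩
  exact ⟨z, p, by simp [ball, hz], fun e he => (hp e he).1⟩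

lemma localEscape_subset_geodesicEscapeEvent {geo : Prop} (hgeo : geo) (o : V) (k : ℕ) :
    G.LocalEscape geo o (k + 1) ⊆ G.GeodesicEscapeEvent o k := by
  rintro S ⟨z, p, hz, hp', hp⟩
  exact ⟨z, p, by simp [ball, hz], by rw [hp' hgeo, hz], fun e he => (hp e he).1⟩

lemma Walk.mul_add_le_time {x y : V} (p : G.Walk x y) {w : E → ℝ≥0} {a δ : ℝ≥0}
    (ha : ∀ e, a ≤ w e) (h : ∃ e ∈ p.edges, a + δ ≤ w e) : p.length * a + δ ≤ p.time w := by
  induction p with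
  | nil => simp at h
  | cons e he p ih =>
    obtain ⟨e', he', hw⟩ := h
    simp only [length_cons, time_cons, Nat.cast_add, Nat.cast_one]
    rcases List.mem_cons.1 he' with rfl | he'
    · calc (p.length + 1) * a + δ = (a + δ) + p.length * a := by ring
        _ ≤ _ := add_le_add hw (p.length_mul_le_time w ha)
    · calc (p.length + 1) * a + δ = a + (p.length * a + δ) := by ring
        _ ≤ _ := add_le_add (ha e) (ih ⟨e', he', hw⟩)

/-- A path to distance `2 r` is slow unless its beginning is a light escape path. -/
lemma Walk.mul_add_le_time_of_not_localEscape (hG : G.Connected) {o z : V} (q : G.Walk o z)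
    {r : ℕ} (hr : 0 < r) (hz : G.dist o z = 2 * r) {w : E → ℝ≥0} {a δ : ℝ≥0} {geo : Prop}
    (ha : ∀ e, a ≤ w e) (hgeo : geo → δ ≤ a)
    (hesc : {e | w e ≤ a + δ} ∉ G.LocalEscape geo o r) :
    (2 * r : ℕ) * a + δ ≤ q.time w := by
  obtain ⟨u, v, q₁, e, h, q₂, rfl, hq₁, hv⟩ := q.exists_prefix_to_sphere hG hr (by omega)
  by_cases hheavy : ∃ e' ∈ (q₁.append (Walk.cons e h q₂)).edges, a + δ ≤ w e'
  · refine le_trans ?_ (Walk.mul_add_le_time _ ha hheavy)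
    gcongr
    rw [← hz]
    exact dist_le_length _
  · push Not at hheavy
    -- All edges are light, so the initial segment fails to be a local escape only through its
    -- length. Then it has at least `r + 1` edges, and the surplus edge costs at least `a ≥ δ`.
    have hnot : ¬ (geo → (q₁.append (Walk.cons e h (Walk.nil v))).length = r) := by
      refine fun hlen => hesc ⟨v, q₁.append (Walk.cons e h (Walk.nil v)), hv, hlen, ?_⟩
      intro e' he'
      simp only [edges_append, edges_cons, edges_nil, List.mem_append, List.mem_cons,
        List.not_mem_nil, or_false] at he'
      constructor
      · refine (hheavy e' ?_).le
        rcases he' with he' | he' <;> simp [he']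
      · rcases he' with he' | rfl
        · exact q₁.edges_subset_nearEdges hq₁ e' he'
        · exact ⟨u, by simp [h], hq₁ u q₁.end_mem_support⟩
    push Not at hnot
    obtain ⟨hg, hlen⟩ := hnot
    have h1 := dist_le_length (q₁.append (Walk.cons e h (Walk.nil v)))
    have h2 := dist_le_length q₂
    have h3 := dist_triangle hG o v z
    have hlong : 2 * r + 1 ≤ (q₁.append (Walk.cons e h q₂)).length := by
      simp only [length_append, length_cons, length_nil] at h1 hlen ⊢
      omega
    calc (2 * r : ℕ) * a + δ ≤ (2 * r : ℕ) * a + a := by gcongr; exact hgeo hg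
      _ = (2 * r + 1 : ℕ) * a := by push_cast; ring
      _ ≤ (q₁.append (Walk.cons e h q₂)).length * a := by gcongr
      _ ≤ _ := Walk.length_mul_le_time _ w ha

section Random

variable {X : Type*} {φ : X → ℝ≥0}

lemma Walk.measurable_time {Ω : Type*} [MeasurableSpace Ω] {x y : V} (p : G.Walk x y)
    {w : Ω → E → ℝ≥0} (hw : ∀ e, Measurable fun ω => w ω e) :
    Measurable fun ω => p.time (w ω) := by
  induction p with
  | nil => simp
  | cons e h p ih =>
    simp only [time_cons]
    exact (hw e).add ih

/-- Locality holds because `LocalEscape` admits only edges near `o`; it makes the event eligible for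
the Peierls estimate. -/
lemma determinedBy_localEscape {B : Set X} (geo : Prop) (o : V) (r : ℕ) :
    DeterminedBy (G.nearEdges o r) {ω : E → X | {e | ω e ∈ B} ∈ G.LocalEscape geo o r} := by
  rintro ω ω' h ⟨z, p, hz, hgeo, hp⟩
  refine ⟨z, p, hz, hgeo, fun e he => ⟨?_, (hp e he).2⟩⟩
  have := (hp e he).1
  rwa [Set.mem_ofPred_eq, h e (hp e he).2] at this

/-- Some path from `o` to the sphere of radius `R`, using edges near `o` only, is faster than `s`. -/
def FastCrossing (G : Multigraph V E) (φ : X → ℝ≥0) (o : V) (R : ℕ) (s : ℝ≥0) : Set (E → X) :=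
  {ω | ∃ (z : V) (p : G.Walk o z), G.dist o z = R ∧ (∀ e ∈ p.edges, e ∈ G.nearEdges o R) ∧
    p.time (φ ∘ ω) < s}

lemma determinedBy_fastCrossing (o : V) (R : ℕ) (s : ℝ≥0) :
    DeterminedBy (G.nearEdges o R) (G.FastCrossing φ o R s) := by
  rintro ω ω' h ⟨z, p, hz, hp, ht⟩
  refine ⟨z, p, hz, hp, ?_⟩
  rwa [p.time_congr (w := φ ∘ ω') (w' := φ ∘ ω) fun e he => by simp [h e (hp e he)]]

variable [MeasurableSpace X] {ρ : Measure X} [IsProbabilityMeasure ρ]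

lemma measurableSet_localEscape [Countable V] [Countable E] {B : Set X} (hB : MeasurableSet B)
    (geo : Prop) (o : V) (r : ℕ) :
    MeasurableSet {ω : E → X | {e | ω e ∈ B} ∈ G.LocalEscape geo o r} := by
  have : {ω : E → X | {e | ω e ∈ B} ∈ G.LocalEscape geo o r} =
      ⋃ (z : V) (p : G.Walk o z) (_ : G.dist o z = r ∧ (geo → p.length = r) ∧
        ∀ e ∈ p.edges, e ∈ G.nearEdges o r), ⋂ e ∈ {e | e ∈ p.edges}, {ω : E → X | ω e ∈ B} := by
    ext ω
    simp only [LocalEscape, Set.mem_ofPred_eq, Set.mem_iUnion, Set.mem_iInter, exists_prop]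
    exact exists_congr fun z => exists_congr fun p => by grind
  rw [this]
  exact MeasurableSet.iUnion fun z => MeasurableSet.iUnion fun p => MeasurableSet.iUnion fun _ =>
    MeasurableSet.biInter (Set.to_countable _) fun e _ => measurable_pi_apply e hB

lemma measurableSet_fastCrossing [Countable V] [Countable E] (hφ : Measurable φ) (o : V) (R : ℕ)
    (s : ℝ≥0) : MeasurableSet (G.FastCrossing φ o R s) := by
  have : G.FastCrossing φ o R s = ⋃ (z : V) (p : G.Walk o z) (_ : G.dist o z = R ∧
      ∀ e ∈ p.edges, e ∈ G.nearEdges o R), {ω | p.time (φ ∘ ω) < s} := by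
    ext ω
    simp only [FastCrossing, Set.mem_ofPred_eq, Set.mem_iUnion, exists_prop, and_assoc]
  rw [this]
  refine MeasurableSet.iUnion fun z => MeasurableSet.iUnion fun p => MeasurableSet.iUnion fun _ =>
    measurableSet_lt (Walk.measurable_time p fun e => ?_) measurable_const
  exact hφ.comp (measurable_pi_apply e)

/-- `geo` records the case: if `a = 0` all light paths count, if `a > 0` only geodesic ones, since a
detour already costs `a`. A local escape to distance `k + 1` leaves the closed ball of radius `k`,
so the decay of percolation applies. -/
lemma ExponentialSubcritical.exists_localEscape_decay [Countable V] [Countable E]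
    (hφ : Measurable φ) (hsub : G.ExponentialSubcritical (ρ.map φ)) :
    ∃ (geo : Prop) (δ : ℝ≥0) (θ : ℝ), (geo → 0 < sInf (ρ.map φ).support) ∧ 0 < δ ∧ 0 < θ ∧
      θ < 1 ∧ ∀ᶠ k : ℕ in atTop, ∀ o, (Measure.infinitePi fun _ : E => ρ)
        {ω | {e | φ (ω e) ≤ sInf (ρ.map φ).support + δ} ∈ G.LocalEscape geo o (k + 1)} ≤
          ENNReal.ofReal (θ ^ k) := by
  have : IsProbabilityMeasure (ρ.map φ) := Measure.isProbabilityMeasure_map hφ.aemeasurable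
  have key : ∀ (A : V → ℕ → Set (Set E)) (geo : Prop)
      (hA : ∀ o k, G.LocalEscape geo o (k + 1) ⊆ A o k)
      (h : (ρ.map φ).real {sInf (ρ.map φ).support} <
        sSup {t : ℝ | ∃ p : I, t = (p : ℝ) ∧ UniformExponentialDecay A p}),
      ∃ (δ : ℝ≥0) (θ : ℝ), 0 < δ ∧ 0 < θ ∧
      θ < 1 ∧ ∀ᶠ k : ℕ in atTop, ∀ o, (Measure.infinitePi fun _ : E => ρ)
        {ω | {e | φ (ω e) ≤ sInf (ρ.map φ).support + δ} ∈ G.LocalEscape geo o (k + 1)} ≤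
          ENNReal.ofReal (θ ^ k) := by
    intro A geo hA h
    -- The supremum of the empty set is 0, which cannot exceed a measure.
    have hne : {t : ℝ | ∃ p : I, t = (p : ℝ) ∧ UniformExponentialDecay A p}.Nonempty := by
      by_contra hne
      rw [Set.not_nonempty_iff_eq_empty.1 hne, Real.sSup_empty] at h
      exact absurd measureReal_nonneg h.not_ge
    obtain ⟨_, ⟨p, rfl, hp⟩, hlt⟩ := exists_lt_of_lt_csSup hne h
    obtain ⟨δ, hδ, hle⟩ := exists_measure_Iic_lt hlt
    obtain ⟨θ, h0, h1, hθ⟩ := hp.exists_le_pow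
    refine ⟨δ, θ, hδ, h0, h1, hθ.mono fun k hk o => ?_⟩
    rw [Measure.map_apply hφ measurableSet_Iic] at hle
    have hB : MeasurableSet (φ ⁻¹' Iic (sInf (ρ.map φ).support + δ)) := hφ measurableSet_Iic
    exact ((measure_setOf_mem_le_setBernoulli hB p hle (isUpperSet_localEscape geo o (k + 1))
      (measurableSet_localEscape hB geo o (k + 1))).trans (measure_mono (hA o k))).trans (hk o)
  rcases hsub with ⟨ha, h⟩ | ⟨ha, h⟩
  · rw [← ha] at h
    obtain ⟨δ, θ, h'⟩ := key G.EscapeEvent False (localEscape_subset_escapeEvent _) h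
    exact ⟨False, δ, θ, False.elim, h'⟩
  · obtain ⟨δ, θ, h'⟩ := key G.GeodesicEscapeEvent True
      (localEscape_subset_geodesicEscapeEvent trivial) h
    exact ⟨True, δ, θ, fun _ => ha, h'⟩

lemma ae_forall_le_weight [Countable E] (hφ : Measurable φ) :
    ∀ᵐ ω ∂(Measure.infinitePi fun _ : E => ρ), ∀ e, sInf (ρ.map φ).support ≤ φ (ω e) := by
  rw [ae_all_iff]
  intro e
  have h1 := ae_of_ae_map hφ.aemeasurable (ae_sInf_support_le (ρ.map φ))
  exact (measurePreserving_eval_infinitePi (fun _ : E => ρ) e).quasiMeasurePreserving.ae h1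

/-- Under exponential subcriticality, crossings at speed slightly larger than the trivial one are
exponentially unlikely. -/
theorem ExponentialSubcritical.exists_fastCrossing_decay (hG : G.Connected)
    (hdeg : G.BoundedDegree) (hgrowth : G.StrictPolynomialGrowth) (hφ : Measurable φ)
    (hsub : G.ExponentialSubcritical (ρ.map φ)) :
    ∃ (δ : ℝ≥0) (L R₀ : ℕ), 0 < δ ∧ 0 < L ∧ ∀ R ≥ R₀, ∀ o,
      (Measure.infinitePi fun _ : E => ρ)
        (G.FastCrossing φ o R (R * (sInf (ρ.map φ).support + δ))) ≤ 2⁻¹ ^ (R / L) := by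
  classical
  have := countable_vertices hgrowth
  have := countable_edges hdeg hgrowth
  obtain ⟨geo, δ₀, θ, hgeo, hδ₀, hθ0, hθ1, hdecay⟩ := hsub.exists_localEscape_decay hφ
  set a := sInf (ρ.map φ).support with ha
  set δ₁ : ℝ≥0 := if geo then min a δ₀ else δ₀ with hδ₁
  have hδ₁pos : 0 < δ₁ := by
    rw [hδ₁]; split_ifs with h
    · exact lt_min (hgeo h) hδ₀
    · exact hδ₀
  have hδ₁le : δ₁ ≤ δ₀ := by
    rw [hδ₁]; split_ifs
    · exact min_le_right _ _
    · exact le_rfl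
  have hδ₁geo : geo → δ₁ ≤ a := fun h => by
    rw [hδ₁, if_pos h]; exact min_le_left _ _
  obtain ⟨k, hk, K, hK, hKq⟩ := (hdecay.and ((tendsto_add_atTop_nat 1).eventually
    (eventually_exists_peierls_bound hgrowth hθ0 hθ1 θ⁻¹ (by positivity)))).exists
  set r := k + 1 with hr
  set Bad : V → Set (E → X) := fun o =>
    {ω | {e | ω e ∈ φ ⁻¹' Iic (a + δ₀)} ∈ G.LocalEscape geo o r} with hBad
  have hpeierls := measure_exists_chain_le (ρ := ρ) hG hgrowth hK (Bad := Bad)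
    (q := ENNReal.ofReal (θ⁻¹ * θ ^ r))
    (fun o => measurableSet_localEscape (hφ measurableSet_Iic) geo o r)
    (fun o => determinedBy_localEscape geo o r)
    (fun o => (hk o).trans (le_of_eq (by rw [hr, pow_succ]; field_simp))) hKq
  set L := 2 * r with hL
  have hL0 : 0 < L := by omega
  have hL0' : (0 : ℝ) < L := by exact_mod_cast hL0
  have hδ₁pos' : (0 : ℝ) < δ₁ := by exact_mod_cast hδ₁pos
  -- If more than half of the `N` steps are good, the time is at least `N L a + N δ₁ / 2`, while a
  -- fast crossing takes less than `(N + 1) (L a + δ₁ / 8)`. The difference `3 N δ₁ / 8` must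
  -- dominate the rounding error `L a + δ₁ / 8`, which is the condition on `N₀`.
  obtain ⟨N₀, hN₀⟩ := exists_nat_ge ((a + δ₁ / (8 * L) : ℝ) * L * 8 / (3 * δ₁))
  refine ⟨δ₁ / (8 * L), L, N₀ * L, by positivity, hL0, fun R hR o => ?_⟩
  refine le_trans ?_ (hpeierls (R / L) o)
  refine measure_mono_ae ?_
  filter_upwards [ae_forall_le_weight (E := E) (ρ := ρ) hφ] with ω hω hfast
  obtain ⟨z, p, hz, -, ht⟩ := hfast
  have hNR : R / L * L ≤ R := Nat.div_mul_le_self R L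
  have hRN : R < (R / L + 1) * L := Nat.lt_mul_of_div_lt (Nat.lt_succ_self _) hL0
  have hNN₀ : N₀ ≤ R / L := (Nat.le_div_iff_mul_le hL0).2 hR
  set N := R / L with hN
  obtain ⟨l, hl, hl1, -, hl3⟩ := p.exists_chain hG hL0 (φ ∘ ω) (L * a) δ₁ (fun o => ω ∈ Bad o)
    (by
      intro o z q hoz
      by_cases hb : ω ∈ Bad o
      · rw [if_pos hb, add_zero]
        refine le_trans ?_ (q.length_mul_le_time (φ ∘ ω) hω)
        gcongr
        rw [← hoz]
        exact dist_le_length _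
      · rw [if_neg hb]
        refine q.mul_add_le_time_of_not_localEscape hG (by omega) hoz hω hδ₁geo fun h => hb ?_
        refine isUpperSet_localEscape geo o r ?_ h
        intro e (he : φ (ω e) ≤ a + δ₁)
        exact he.trans (by gcongr)) N (by rw [hz]; exact hNR)
  refine ⟨l, hl, hl1, ?_⟩
  by_contra hcon
  push Not at hcon
  have hlen := length_of_mem_chains hl
  have hcount := List.length_eq_countP_add_countP (fun o => decide (ω ∈ Bad o)) (l := l)
  have hgood : N < 2 * l.countP (fun o => ¬ ω ∈ Bad o) := by
    have : l.countP (fun o => decide (¬ ω ∈ Bad o)) =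
        l.countP (fun a => decide ¬ (decide (ω ∈ Bad a) = true)) := by
      congr 1; ext o; simp
    omega
  have h1 := (hl3.trans_lt ht)
  set g := l.countP (fun o => ¬ ω ∈ Bad o)
  have h2 : (N : ℝ) * (L * a) + g * δ₁ < R * (a + δ₁ / (8 * L)) := by exact_mod_cast h1
  have h3 : (N : ℝ) < 2 * g := by exact_mod_cast hgood
  have h4 : (R : ℝ) ≤ (N + 1) * L := by exact_mod_cast hRN.le
  have h5 : (N₀ : ℝ) ≤ N := by exact_mod_cast hNN₀
  have h6 : (a + δ₁ / (8 * L) : ℝ) * L * 8 ≤ N * (3 * δ₁) :=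
    (div_le_iff₀ (by positivity)).1 (hN₀.trans h5)
  have h7 : (R : ℝ) * (a + δ₁ / (8 * L)) ≤ (N + 1) * L * (a + δ₁ / (8 * L)) := by gcongr
  have h8 : (L : ℝ) * (δ₁ / (8 * L)) = δ₁ / 8 := by field_simp
  have h9 : (N : ℝ) * δ₁ ≤ 2 * g * δ₁ := by gcongr
  have h10 : (a + δ₁ / (8 * L) : ℝ) * L * 8 = 8 * (L * a) + δ₁ := by
    rw [add_mul, add_mul, mul_comm (δ₁ / (8 * L) : ℝ), h8]; ring
  have h11 : (N + 1) * L * (a + δ₁ / (8 * L)) = (N + 1) * (L * a) + (N + 1) * (δ₁ / 8 : ℝ) := by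
    rw [← h8]; ring
  nlinarith

end Random

end Multigraph

/-! ### Existence of geodesics and the local modification -/

namespace Multigraph

variable {V E : Type*} {G : Multigraph V E}

lemma passageTime_le (w : E → ℝ≥0) {x y : V} (p : G.Walk x y) : G.passageTime w x y ≤ p.time w :=
  ciInf_le (OrderBot.bddBelow _) p

lemma finite_selfAvoidingPath_edges_subset {S : Set E} (hS : S.Finite) (x y : V) :
    {p : G.SelfAvoidingPath x y | ∀ e ∈ p.1.edges, e ∈ S}.Finite := by
  have hfin : {l : List E | (∀ e ∈ l, e ∈ S) ∧ l.length ≤ S.ncard}.Finite := by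
    have : Finite S := hS
    refine ((List.finite_length_le S S.ncard).image (List.map Subtype.val)).subset ?_
    rintro l ⟨hl, hlen⟩
    refine ⟨l.attach.map fun e => ⟨e.1, hl e.1 e.2⟩, by simpa using hlen, ?_⟩
    simp [Function.comp_def]
  refine Set.Finite.of_finite_image (f := fun p => p.1.edges) (hfin.subset ?_) ?_
  · rintro _ ⟨p, hp, rfl⟩
    refine ⟨hp, ?_⟩
    classical
    rw [Set.ncard_eq_toFinset_card _ hS,
      ← List.toFinset_card_of_nodup (Walk.IsSelfAvoiding.edges_nodup p.2)]
    refine Finset.card_le_card fun e he => ?_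
    simpa using hp e (by simpa using he)
  · intro p _ q _ h
    exact Subtype.ext (Walk.edges_injective h)

/-- If distant points take longer to reach than `y`, then there is a geodesic to `y`. -/
lemma exists_isTGeodesic (hG : G.Connected) (hdeg : G.BoundedDegree)
    (hgrowth : G.StrictPolynomialGrowth) {w : E → ℝ≥0} {x y : V} {R : ℕ} (hR : 0 < R) {c : ℝ≥0}
    (hc : G.passageTime w x y < c)
    (hfar : ∀ (z : V) (p : G.Walk x z), G.dist x z = R → c ≤ p.time w) :
    ∃ p : G.SelfAvoidingPath x y, G.IsTGeodesic w p := by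
  -- Competitive paths never reach the sphere, so after loop erasure only finitely many candidates
  -- remain.
  have hnear : ∀ p : G.Walk x y, p.time w < c → ∀ e ∈ p.edges, e ∈ G.nearEdges x R := by
    intro p hp
    refine p.edges_subset_nearEdges fun z hz => ?_
    by_contra hcon
    obtain ⟨q, q', rfl⟩ := p.exists_append_of_mem_support hz
    obtain ⟨u, v, q₁, e, h, q₂, rfl, -, hv⟩ := q.exists_prefix_to_sphere hG hR (not_lt.1 hcon)
    have h1 := hfar v (q₁.append (Walk.cons e h (Walk.nil v))) hv
    simp only [Walk.time_append, Walk.time_cons, Walk.time_nil, add_zero] at h1 hp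
    have h2 : q₁.time w + w e ≤ q₁.time w + (w e + q₂.time w) + q'.time w := by
      rw [← add_assoc, add_assoc]; exact le_self_add
    exact absurd hp (not_lt.2 (h1.trans h2))
  have := hG x y
  obtain ⟨p₀, hp₀⟩ := exists_lt_of_ciInf_lt hc
  have hsa : ∀ p : G.Walk x y, p.time w < c → ∃ q : G.SelfAvoidingPath x y,
      (∀ e ∈ q.1.edges, e ∈ G.nearEdges x R) ∧ q.1.time w ≤ p.time w := by
    intro p hp
    obtain ⟨q, hq, hsub⟩ := p.exists_selfAvoiding
    have hle := Walk.time_le_of_sublist p q hsub w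
    exact ⟨⟨q, hq⟩, hnear q (hle.trans_lt hp), hle⟩
  obtain ⟨q₀, hq₀, hq₀'⟩ := hsa p₀ hp₀
  obtain ⟨q, -, hmin⟩ := Set.exists_min_image _ (fun q : G.SelfAvoidingPath x y => q.1.time w)
    (finite_selfAvoidingPath_edges_subset (finite_nearEdges hdeg hgrowth x R) x y) ⟨q₀, hq₀⟩
  refine ⟨q, le_antisymm (le_ciInf fun p => ?_) (passageTime_le w q.1)⟩
  rcases lt_or_ge (p.time w) c with hp | hp
  · obtain ⟨q', h1, h2⟩ := hsa p hp
    exact (hmin q' h1).trans h2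
  · exact (hmin q₀ hq₀).trans (hq₀'.trans (hp₀.le.trans hp))

/-- The effect of lowering the weights near a vertex of a geodesic: if the edges inside the ball
get low weights, so that the crossing of the ball becomes faster in spite of the new weights of the
edges which lead to the sphere, then any new geodesic uses one of the latter edges. -/
lemma IsTGeodesic.exists_mem_edges_of_modification (hG : G.Connected) {w w' : E → ℝ≥0} {o x y : V}
    {R : ℕ} (hR : 0 < R) {s b M : ℝ≥0}
    (hcross : ∀ (z : V) (p : G.Walk o z), G.dist o z = R → s ≤ p.time w)
    (hoff : ∀ e, e ∉ G.nearEdges o R → w' e = w e)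
    (hinner : ∀ e, (∀ v ∈ G.ends e, G.dist o v < R) → w' e ≤ b)
    (htop : ∀ e ∈ G.nearEdges o R, (∃ v ∈ G.ends e, R ≤ G.dist o v) → w' e ≤ M)
    (hs : R * b + M < s) (hx : R ≤ G.dist o x) (hy : R ≤ G.dist o y)
    {p₀ p : G.SelfAvoidingPath x y} (hp₀ : G.IsTGeodesic w p₀) (ho : o ∈ p₀.1.support)
    (hp : G.IsTGeodesic w' p) :
    ∃ e ∈ p.1.edges, e ∈ G.nearEdges o R ∧ ∃ v ∈ G.ends e, R ≤ G.dist o v := by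
  have ho0 : ¬ R ≤ G.dist o o := by rw [dist_self]; omega
  have hout : ∀ {u v : V} (q : G.Walk u v), (∀ z ∈ q.support, R ≤ G.dist o z) →
      q.time w' = q.time w := by
    intro u v q hq
    refine q.time_congr fun e he => hoff e ?_
    rintro ⟨z, hz, hz'⟩
    exact absurd (hq z (q.mem_support_of_mem_ends he hz)) (not_le.2 hz')
  -- A graph geodesic from `o` has only its last edge touching the sphere: the other edges cost at
  -- most `b` each and the last at most `M`.
  have hradial : ∀ u, G.dist o u = R → ∃ g : G.Walk o u, g.time w' ≤ R * b + M := by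
    intro u hu
    obtain ⟨g, hg⟩ := exists_walk_length_eq hG o u
    obtain ⟨z, v, q, e, h, q', rfl, hq, hv⟩ := g.exists_prefix_to_sphere hG hR hu.ge
    refine ⟨q.append (Walk.cons e h q'), ?_⟩
    have hlen := dist_le_length (q.append (Walk.cons e h (Walk.nil v)))
    simp only [Walk.length_append, Walk.length_cons, Walk.length_nil] at hlen hg
    have hq'0 : q'.length = 0 := by omega
    have hq't : q'.time w' = 0 := by
      rw [Walk.time, List.length_eq_zero_iff.1 hq'0]; simp
    rw [Walk.time_append, Walk.time_cons, hq't, add_zero]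
    refine add_le_add ((q.time_le_length_mul w' (b := b) fun e he => hinner e fun z hz =>
      hq z (q.mem_support_of_mem_ends he hz)).trans ?_) ?_
    · gcongr; omega
    · exact htop e ⟨z, by simp [h], hq z q.end_mem_support⟩ ⟨v, by simp [h], hv.ge⟩
  -- The old path is kept until it first enters the open ball, then replaced by a radial path. The
  -- discarded part crosses the ball and so took at least `s`.
  have hentry : ∀ {z : V} (q : G.Walk z o), R ≤ G.dist o z →
      ∃ q' : G.Walk z o, q'.time w' < q.time w := by
    intro z q hz
    obtain ⟨u, v, q₁, e, h, q₂, rfl, hq₁, hv⟩ := q.exists_first_exit (fun z => R ≤ G.dist o z)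
      hz ho0
    have hu : G.dist o u = R := by
      have h1 := hq₁ u q₁.end_mem_support
      have h2 := dist_le_succ hG (h.trans Sym2.eq_swap) o
      omega
    obtain ⟨g, hg⟩ := hradial u hu
    refine ⟨q₁.append g.reverse, ?_⟩
    have h1 := hcross u (Walk.cons e h q₂).reverse hu
    rw [Walk.time_reverse] at h1
    rw [Walk.time_append, Walk.time_append, hout q₁ hq₁, Walk.time_reverse]
    exact add_lt_add_right (hg.trans_lt (hs.trans_le h1)) _
  have hless : G.passageTime w' x y < G.passageTime w x y := by
    obtain ⟨q, q', hqq⟩ := p₀.1.exists_append_of_mem_support ho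
    obtain ⟨r, hr⟩ := hentry q hx
    obtain ⟨r', hr'⟩ := hentry q'.reverse hy
    rw [← hp₀, hqq, Walk.time_append]
    refine (passageTime_le w' (r.append r'.reverse)).trans_lt ?_
    rw [Walk.time_append, Walk.time_reverse]
    rw [Walk.time_reverse] at hr'
    exact add_lt_add hr hr'
  by_contra hcon
  push Not at hcon
  -- A new geodesic using no edge between the open ball and its complement stays outside the ball,
  -- where the weights are unchanged. It would then take at least the old passage time,
  -- contradicting `hless`.
  have hsupp : ∀ z ∈ p.1.support, R ≤ G.dist o z := by
    intro z hz
    by_contra hlt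
    obtain ⟨q, q', hqq⟩ := p.1.exists_append_of_mem_support hz
    obtain ⟨u, v, q₁, e, h, q₂, rfl, hq₁, hv⟩ := q.exists_first_exit (fun z => R ≤ G.dist o z)
      hx hlt
    refine absurd (hq₁ u q₁.end_mem_support) (not_le.2 ?_)
    exact hcon e (by simp [hqq]) ⟨v, by simp [h], not_le.1 hv⟩ u (by simp [h])
  have h1 := passageTime_le w p.1
  rw [← hout p.1 hsupp, hp] at h1
  exact absurd hless (not_lt.2 h1)

section Random

variable {X : Type*} {φ : X → ℝ≥0}

/-- Stopping at the first arrival on the sphere gives a path that uses near edges only and is no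
slower. Hence the local event controls all paths to the sphere. -/
lemma le_time_of_notMem_fastCrossing (hG : G.Connected) {o : V} {R : ℕ} (hR : 0 < R) {s : ℝ≥0}
    {ω : E → X} (hω : ω ∉ G.FastCrossing φ o R s) (z : V) (p : G.Walk o z)
    (hz : G.dist o z = R) : s ≤ p.time (φ ∘ ω) := by
  obtain ⟨u, v, q₁, e, h, q₂, rfl, hq₁, hv⟩ := p.exists_prefix_to_sphere hG hR hz.ge
  by_contra hcon
  push Not at hcon
  refine hω ⟨v, q₁.append (Walk.cons e h (Walk.nil v)), hv, fun e' he' => ?_, ?_⟩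
  · simp only [Walk.edges_append, Walk.edges_cons, Walk.edges_nil, List.mem_append, List.mem_cons,
      List.not_mem_nil, or_false] at he'
    rcases he' with he' | rfl
    · exact q₁.edges_subset_nearEdges hq₁ e' he'
    · exact ⟨u, by simp [h], hq₁ u q₁.end_mem_support⟩
  · refine lt_of_le_of_lt ?_ hcon
    simp only [Walk.time_append, Walk.time_cons, Walk.time_nil, add_zero]
    gcongr
    exact le_self_add

variable [MeasurableSpace X] {ρ : Measure X} [IsProbabilityMeasure ρ]

lemma measurable_passageTime [Countable E] {Ω : Type*} [MeasurableSpace Ω] {w : Ω → E → ℝ≥0}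
    (hw : ∀ e, Measurable fun ω => w ω e) (x y : V) :
    Measurable fun ω => G.passageTime (w ω) x y :=
  Measurable.iInf fun p => p.measurable_time hw

lemma lintegral_time (hφ : Measurable φ) {x y : V} (p : G.Walk x y) :
    ∫⁻ ω, (p.time (φ ∘ ω) : ℝ≥0∞) ∂(Measure.infinitePi fun _ : E => ρ) =
      p.length * ∫⁻ t, (t : ℝ≥0∞) ∂(ρ.map φ) := by
  induction p with
  | nil => simp
  | cons e h p ih =>
    have h1 : Measurable fun ω : E → X => (φ (ω e) : ℝ≥0∞) := by fun_prop
    simp only [Walk.time_cons, ENNReal.coe_add, Function.comp_apply, Walk.length_cons]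
    rw [lintegral_add_left h1, ih]
    have h2 : ∫⁻ ω, (φ (ω e) : ℝ≥0∞) ∂(Measure.infinitePi fun _ : E => ρ) =
        ∫⁻ t, (t : ℝ≥0∞) ∂(ρ.map φ) := by
      rw [lintegral_map (by fun_prop) hφ]
      exact (measurePreserving_eval_infinitePi (fun _ : E => ρ) e).lintegral_comp
        (f := fun t => (φ t : ℝ≥0∞)) (by fun_prop)
    rw [h2]
    push_cast
    ring

/-- Under exponential subcriticality, geodesics exist almost surely. -/
lemma ExponentialSubcritical.ae_exists_isTGeodesic (hG : G.Connected)
    (hdeg : G.BoundedDegree) (hgrowth : G.StrictPolynomialGrowth) (hφ : Measurable φ)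
    (hmean : HasFiniteMean (ρ.map φ)) (hsub : G.ExponentialSubcritical (ρ.map φ)) (x y : V) :
    ∀ᵐ ω ∂(Measure.infinitePi fun _ : E => ρ),
      ∃ p : G.SelfAvoidingPath x y, G.IsTGeodesic (φ ∘ ω) p := by
  obtain ⟨δ, L, R₀, hδ, hL, hfast⟩ := hsub.exists_fastCrossing_decay hG hdeg hgrowth hφ
  set s := sInf (ρ.map φ).support + δ with hs
  have hs0 : 0 < s := lt_of_lt_of_le hδ le_add_self
  obtain ⟨p⟩ := hG x y
  have hT : ∫⁻ ω, (p.time (φ ∘ ω) : ℝ≥0∞) ∂(Measure.infinitePi fun _ : E => ρ) ≠ ∞ := by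
    rw [lintegral_time hφ]
    exact ENNReal.mul_ne_top (by simp) hmean.ne
  set T := ∫⁻ ω, (p.time (φ ∘ ω) : ℝ≥0∞) ∂(Measure.infinitePi fun _ : E => ρ)
  -- Without a geodesic, either the ball of radius `R` around `x` has a fast crossing or the fixed
  -- path `p` takes at least `R s`. Markov's inequality bounds the latter, and both bounds vanish as
  -- `R → ∞`.
  have hbound : ∀ᶠ R : ℕ in atTop, (Measure.infinitePi fun _ : E => ρ)
      {ω | ∃ p : G.SelfAvoidingPath x y, G.IsTGeodesic (φ ∘ ω) p}ᶜ ≤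
        2⁻¹ ^ (R / L) + T / ((R * s : ℝ≥0) : ℝ≥0∞) := by
    filter_upwards [eventually_ge_atTop R₀, eventually_gt_atTop 0] with R hR hR0
    have hRs : (0 : ℝ≥0) < R * s := by positivity
    have hmarkov := meas_ge_le_lintegral_div (μ := Measure.infinitePi fun _ : E => ρ)
      (f := fun ω => (p.time (φ ∘ ω) : ℝ≥0∞)) (ε := ((R * s : ℝ≥0) : ℝ≥0∞))
      (p.measurable_time fun e => hφ.comp (measurable_pi_apply e)).coe_nnreal_ennreal.aemeasurable
      (by simpa using hRs.ne') ENNReal.coe_ne_top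
    refine le_trans (measure_mono ?_) ((measure_union_le _ _).trans
      (add_le_add (hfast R hR x) hmarkov))
    intro ω hω
    by_contra hcon
    rw [Set.mem_union, not_or, Set.mem_ofPred_eq, not_le, ENNReal.coe_lt_coe] at hcon
    exact hω (exists_isTGeodesic hG hdeg hgrowth hR0 ((passageTime_le _ p).trans_lt hcon.2)
      (le_time_of_notMem_fastCrossing hG hR0 hcon.1))
  have hlim1 : Tendsto (fun R : ℕ => (2⁻¹ : ℝ≥0∞) ^ (R / L)) atTop (nhds 0) :=
    (ENNReal.tendsto_pow_atTop_nhds_zero_of_lt_one (by simp)).comp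
      (Nat.tendsto_div_const_atTop hL.ne')
  have hlim2 : Tendsto (fun R : ℕ => T / ((R * s : ℝ≥0) : ℝ≥0∞)) atTop (nhds 0) := by
    have h1 : Tendsto (fun R : ℕ => ((R * s : ℝ≥0) : ℝ≥0∞)) atTop (nhds ∞) := by
      rw [ENNReal.tendsto_coe_nhds_top]
      exact tendsto_natCast_atTop_atTop.atTop_mul_const hs0
    simpa using ENNReal.Tendsto.const_div h1 (Or.inr hT)
  have hlim := hlim1.add hlim2
  rw [add_zero] at hlim
  exact le_antisymm (ge_of_tendsto hlim hbound) zero_le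

end Random

end Multigraph

/-! ### The selected geodesic: measurability and resampling -/

namespace Multigraph

variable {V E : Type*} {G : Multigraph V E}

/-- `p` is the `T`-geodesic from `x` to `y`, that is, the least one for the well-ordering `r`. -/
def IsLeastTGeodesic (G : Multigraph V E)
    (r : ∀ x y : V, G.SelfAvoidingPath x y → G.SelfAvoidingPath x y → Prop)
    (w : E → ℝ≥0) {x y : V} (p : G.SelfAvoidingPath x y) : Prop :=
  G.IsTGeodesic w p ∧ ∀ p' : G.SelfAvoidingPath x y, G.IsTGeodesic w p' → ¬ r x y p' p

section Least

variable {r : ∀ x y : V, G.SelfAvoidingPath x y → G.SelfAvoidingPath x y → Prop}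

lemma mem_geodesicEdges_iff {w : E → ℝ≥0} {x y : V} {e : E} :
    e ∈ G.geodesicEdges r w x y ↔
      ∃ p : G.SelfAvoidingPath x y, G.IsLeastTGeodesic r w p ∧ e ∈ p.1.edges := by
  simp only [geodesicEdges, IsLeastTGeodesic, Set.mem_ofPred_eq, and_assoc]

variable (hr : ∀ x y : V, IsWellOrder (G.SelfAvoidingPath x y) (r x y))
include hr

lemma exists_isLeastTGeodesic {w : E → ℝ≥0} {x y : V}
    (h : ∃ p : G.SelfAvoidingPath x y, G.IsTGeodesic w p) :
    ∃ p : G.SelfAvoidingPath x y, G.IsLeastTGeodesic r w p :=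
  (hr x y).wf.has_min {p | G.IsTGeodesic w p} h

lemma IsLeastTGeodesic.unique {w : E → ℝ≥0} {x y : V} {p q : G.SelfAvoidingPath x y}
    (hp : G.IsLeastTGeodesic r w p) (hq : G.IsLeastTGeodesic r w q) : p = q := by
  have := hr x y
  rcases trichotomous_of (r x y) p q with h | h | h
  · exact absurd h (hq.2 p hp.1)
  · exact h
  · exact absurd h (hp.2 q hq.1)

lemma IsLeastTGeodesic.geodesicEdges_eq {w : E → ℝ≥0} {x y : V} {p : G.SelfAvoidingPath x y}
    (hp : G.IsLeastTGeodesic r w p) : G.geodesicEdges r w x y = {e | e ∈ p.1.edges} := by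
  ext e
  rw [mem_geodesicEdges_iff]
  constructor
  · rintro ⟨q, hq, he⟩
    rwa [IsLeastTGeodesic.unique hr hp hq]
  · exact fun he => ⟨p, hp, he⟩

end Least

section Measurability

variable {X : Type*} [MeasurableSpace X] {φ : X → ℝ≥0}
  {r : ∀ x y : V, G.SelfAvoidingPath x y → G.SelfAvoidingPath x y → Prop}

lemma measurableSet_isTGeodesic [Countable E] (hφ : Measurable φ) {x y : V}
    (p : G.SelfAvoidingPath x y) : MeasurableSet {ω : E → X | G.IsTGeodesic (φ ∘ ω) p} := by
  have hw : ∀ e : E, Measurable fun ω : E → X => (φ ∘ ω) e := fun e =>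
    hφ.comp (measurable_pi_apply e)
  exact measurableSet_eq_fun (p.1.measurable_time hw) (measurable_passageTime hw x y)

lemma measurableSet_isLeastTGeodesic [Countable E] (hφ : Measurable φ) {x y : V}
    (p : G.SelfAvoidingPath x y) :
    MeasurableSet {ω : E → X | G.IsLeastTGeodesic r (φ ∘ ω) p} := by
  refine (measurableSet_isTGeodesic hφ p).inter ?_
  have : {ω : E → X | ∀ p' : G.SelfAvoidingPath x y, G.IsTGeodesic (φ ∘ ω) p' → ¬ r x y p' p} =
      ⋂ (p' : G.SelfAvoidingPath x y) (_ : r x y p' p), {ω | G.IsTGeodesic (φ ∘ ω) p'}ᶜ := by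
    ext ω
    simp only [Set.mem_ofPred_eq, Set.mem_iInter, Set.mem_compl_iff]
    exact forall_congr' fun p' => imp_not_comm
  refine (congrArg MeasurableSet this).mpr <| MeasurableSet.iInter fun p' => MeasurableSet.iInter fun _ =>
    (measurableSet_isTGeodesic hφ p').compl

lemma measurableSet_mem_geodesicEdges [Countable E] (hφ : Measurable φ) {A : Set X}
    (hA : MeasurableSet A) (x y : V) (e : E) :
    MeasurableSet {ω : E → X | e ∈ G.geodesicEdges r (φ ∘ ω) x y ∧ ω e ∈ A} := by
  refine MeasurableSet.inter ?_ (measurable_pi_apply e hA)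
  have : {ω : E → X | e ∈ G.geodesicEdges r (φ ∘ ω) x y} =
      ⋃ (p : G.SelfAvoidingPath x y) (_ : e ∈ p.1.edges),
        {ω | G.IsLeastTGeodesic r (φ ∘ ω) p} := by
    ext ω
    simp only [mem_geodesicEdges_iff, Set.mem_ofPred_eq, Set.mem_iUnion, exists_prop]
    exact exists_congr fun p => and_comm
  refine (congrArg MeasurableSet this).mpr <| MeasurableSet.iUnion fun p => MeasurableSet.iUnion fun _ =>
    measurableSet_isLeastTGeodesic hφ p

/-- The geodesic from `x` to `y` visits `o`, whose ball of radius `R` has no fast crossing. -/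
def GoodVisit (G : Multigraph V E) (φ : X → ℝ≥0)
    (r : ∀ x y : V, G.SelfAvoidingPath x y → G.SelfAvoidingPath x y → Prop)
    (R : ℕ) (s : ℝ≥0) (x y o : V) : Set (E → X) :=
  {ω | (∃ p : G.SelfAvoidingPath x y, G.IsLeastTGeodesic r (φ ∘ ω) p ∧ o ∈ p.1.support) ∧
    ω ∉ G.FastCrossing φ o R s ∧ R ≤ G.dist o x ∧ R ≤ G.dist o y}

lemma measurableSet_goodVisit [Countable V] [Countable E] (hφ : Measurable φ) (R : ℕ) (s : ℝ≥0)
    (x y o : V) : MeasurableSet (G.GoodVisit φ r R s x y o) := by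
  refine MeasurableSet.inter ?_ ((measurableSet_fastCrossing hφ o R s).compl.inter
    (MeasurableSet.const _))
  have : {ω : E → X | ∃ p : G.SelfAvoidingPath x y,
      G.IsLeastTGeodesic r (φ ∘ ω) p ∧ o ∈ p.1.support} =
      ⋃ (p : G.SelfAvoidingPath x y) (_ : o ∈ p.1.support),
        {ω | G.IsLeastTGeodesic r (φ ∘ ω) p} := by
    ext ω
    simp only [Set.mem_ofPred_eq, Set.mem_iUnion, exists_prop]
    exact exists_congr fun p => and_comm
  refine (congrArg MeasurableSet this).mpr <| MeasurableSet.iUnion fun p => MeasurableSet.iUnion fun _ =>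
    measurableSet_isLeastTGeodesic hφ p

end Measurability

section Resampling

variable {X : Type*} [MeasurableSpace X] {ρ : Measure X} [IsProbabilityMeasure ρ] {φ : X → ℝ≥0}
  {r : ∀ x y : V, G.SelfAvoidingPath x y → G.SelfAvoidingPath x y → Prop}

/-- Resampling the edges near a good vertex of the geodesic makes the geodesic use an edge with mark
in `A` with a probability that is bounded below. -/
lemma measure_goodVisit_mul_le (hG : G.Connected) (hdeg : G.BoundedDegree)
    (hgrowth : G.StrictPolynomialGrowth) (hφ : Measurable φ)
    (hgeod : ∀ x y, ∀ᵐ ω ∂(Measure.infinitePi fun _ : E => ρ),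
      ∃ p : G.SelfAvoidingPath x y, G.IsTGeodesic (φ ∘ ω) p)
    (hr : ∀ x y : V, IsWellOrder (G.SelfAvoidingPath x y) (r x y))
    {A : Set X} (hA : MeasurableSet A) {M b s : ℝ≥0} (hAM : ∀ t ∈ A, φ t ≤ M)
    {R m : ℕ} (hR : 0 < R) (hs : R * b + M < s) (hm : ∀ o, (G.nearEdges o R).ncard ≤ m)
    (x y o : V) :
    (Measure.infinitePi fun _ : E => ρ) (G.GoodVisit φ r R s x y o) *
        (min (ρ A) (ρ (φ ⁻¹' Iic b))) ^ m ≤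
      (Measure.infinitePi fun _ : E => ρ)
        {ω | ∃ e ∈ G.nearEdges o R, e ∈ G.geodesicEdges r (φ ∘ ω) x y ∧ ω e ∈ A} := by
  classical
  have := countable_edges hdeg hgrowth
  set F : Set (E → X) :=
    {ω | ∃ e ∈ G.nearEdges o R, e ∈ G.geodesicEdges r (φ ∘ ω) x y ∧ ω e ∈ A} with hF
  -- The resampling inclusion must hold for every configuration, while geodesics exist only almost
  -- surely; the null set of exceptions is therefore added to the target.
  set F' : Set (E → X) := F ∪ {ω | ∃ p : G.SelfAvoidingPath x y, G.IsTGeodesic (φ ∘ ω) p}ᶜ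
    with hF'
  have hFF' : F' =ᵐ[Measure.infinitePi fun _ : E => ρ] F := by
    rw [hF']
    exact union_ae_eq_left_of_ae_eq_empty (ae_eq_empty.2 (hgeod x y))
  have hFm : MeasurableSet F := by
    have : F = ⋃ e ∈ G.nearEdges o R,
        {ω : E → X | e ∈ G.geodesicEdges r (φ ∘ ω) x y ∧ ω e ∈ A} := by
      ext ω
      simp only [hF, Set.mem_ofPred_eq, Set.mem_iUnion, exists_prop]
    rw [this]
    exact MeasurableSet.biUnion (Set.to_countable _) fun e _ =>
      measurableSet_mem_geodesicEdges hφ hA x y e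
  rw [← measure_congr hFF']
  have hfin := finite_nearEdges hdeg hgrowth o R
  -- Any path entering the open ball uses a near edge with an endpoint outside, so exactly those
  -- edges get marks in `A`.
  set Q : E → Set X := fun e => if ∃ v ∈ G.ends e, R ≤ G.dist o v then A else φ ⁻¹' Iic b with hQ
  set κ := min (ρ A) (ρ (φ ⁻¹' Iic b)) with hκ
  have hprod : κ ^ m ≤ ∏ e ∈ hfin.toFinset, ρ (Q e) := by
    calc κ ^ m ≤ κ ^ hfin.toFinset.card := by
          refine pow_le_pow_right_of_le_one' ((min_le_left _ _).trans prob_le_one) ?_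
          rw [← Set.ncard_eq_toFinset_card _ hfin]
          exact hm o
      _ = ∏ e ∈ hfin.toFinset, κ := by rw [Finset.prod_const]
      _ ≤ _ := by
          refine Finset.prod_le_prod' fun e _ => ?_
          rw [hQ]
          dsimp only
          split_ifs
          · exact min_le_left _ _
          · exact min_le_right _ _
  refine (mul_le_mul_right hprod _).trans (measure_mul_prod_le_of_resample hfin ?_
    (hFm.nullMeasurableSet.congr hFF'.symm) ?_)
  · intro e
    rw [hQ]
    dsimp only
    split_ifs
    · exact hA
    · exact hφ measurableSet_Iic
  rintro ω ⟨⟨p₀, hp₀, ho⟩, hfast, hx, hy⟩ ω' hω'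
  set ω'' := (G.nearEdges o R).piecewise ω' ω with hω''
  have hin : ∀ e ∈ G.nearEdges o R, ω'' e ∈ Q e := fun e he => by
    rw [hω'', Set.piecewise_eq_of_mem _ _ _ he]
    exact hω' e he
  by_cases hex : ∃ p : G.SelfAvoidingPath x y, G.IsTGeodesic (φ ∘ ω'') p
  swap
  · exact Or.inr hex
  left
  obtain ⟨p, hp⟩ := exists_isLeastTGeodesic hr hex
  obtain ⟨e, he, hnear, htop⟩ := hp₀.1.exists_mem_edges_of_modification hG hR (w' := φ ∘ ω'')
    (b := b) (M := M) (le_time_of_notMem_fastCrossing hG hR hfast)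
    (fun e he => by
      rw [Function.comp_apply, Function.comp_apply, hω'', Set.piecewise_eq_of_notMem _ _ _ he])
    (fun e he => by
      obtain ⟨v, hv⟩ : ∃ v, v ∈ G.ends e := ⟨_, Sym2.out_fst_mem _⟩
      have := hin e ⟨v, hv, he v hv⟩
      rw [hQ] at this
      dsimp only at this
      rwa [if_neg (by push Not; exact he)] at this)
    (fun e he htop => by
      have := hin e he
      rw [hQ] at this
      dsimp only at this
      rw [if_pos htop] at this
      exact hAM _ this)
    hs hx hy ho hp.1
  refine ⟨e, hnear, mem_geodesicEdges_iff.2 ⟨p, hp, he⟩, ?_⟩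
  have := hin e hnear
  rw [hQ] at this
  dsimp only at this
  rwa [if_pos htop] at this

end Resampling

end Multigraph

/-! ### Linear density of the marked edges on the geodesic -/

namespace Multigraph

variable {V E : Type*} {G : Multigraph V E}

section Counting

variable {X : Type*} [MeasurableSpace X] {ρ : Measure X} [IsProbabilityMeasure ρ] {φ : X → ℝ≥0}
  {r : ∀ x y : V, G.SelfAvoidingPath x y → G.SelfAvoidingPath x y → Prop}

omit [IsProbabilityMeasure ρ] in
lemma lintegral_encard_geodesicEdges [Countable E] (hφ : Measurable φ) {A : Set X}
    (hA : MeasurableSet A) (x y : V) :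
    ∫⁻ ω, ({e ∈ G.geodesicEdges r (φ ∘ ω) x y | ω e ∈ A}.encard : ℝ≥0∞)
        ∂(Measure.infinitePi fun _ : E => ρ) =
      ∑' e, (Measure.infinitePi fun _ : E => ρ)
        {ω | e ∈ G.geodesicEdges r (φ ∘ ω) x y ∧ ω e ∈ A} := by
  have h1 : ∀ ω : E → X, ({e ∈ G.geodesicEdges r (φ ∘ ω) x y | ω e ∈ A}.encard : ℝ≥0∞) =
      ∑' e, {ω : E → X | e ∈ G.geodesicEdges r (φ ∘ ω) x y ∧ ω e ∈ A}.indicator 1 ω := by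
    intro ω
    rw [← ENNReal.tsum_set_one, tsum_subtype _ (fun _ => (1 : ℝ≥0∞))]
    rfl
  simp_rw [h1]
  rw [lintegral_tsum fun e => (measurable_one.indicator
    (measurableSet_mem_geodesicEdges hφ hA x y e)).aemeasurable]
  exact tsum_congr fun e => lintegral_indicator_one (measurableSet_mem_geodesicEdges hφ hA x y e)

lemma encard_setOf_mem_nearEdges_le (hG : G.Connected) (hgrowth : G.StrictPolynomialGrowth)
    {R K : ℕ} (hK : ∀ o, {y | G.dist o y ≤ 2 * R}.ncard ≤ K) (e : E) :
    {o | e ∈ G.nearEdges o R}.encard ≤ K := by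
  rcases Set.eq_empty_or_nonempty {o | e ∈ G.nearEdges o R} with h | ⟨o', v', hv', ho'⟩
  · simp [h]
  have hfin := finite_closedBall hgrowth o' (2 * R)
  have hsub : {o | e ∈ G.nearEdges o R} ⊆ {y | G.dist o' y ≤ 2 * R} := by
    intro o ho
    by_contra hcon
    rw [Set.mem_ofPred_eq, not_le] at hcon
    exact Set.disjoint_left.1 (disjoint_nearEdges hG hcon.le) ⟨v', hv', ho'⟩ ho
  refine (Set.encard_le_encard hsub).trans ?_
  rw [← hfin.cast_ncard_eq]
  exact_mod_cast hK o'

omit [IsProbabilityMeasure ρ] in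
-- Union bound over the edges near each centre, then exchange of the two sums: one edge is near at
-- most `K` centres.
lemma tsum_measure_exists_mem_nearEdges_le (hG : G.Connected) (hdeg : G.BoundedDegree)
    (hgrowth : G.StrictPolynomialGrowth) (hφ : Measurable φ) {A : Set X} (hA : MeasurableSet A)
    {R K : ℕ} (hK : ∀ o, {y | G.dist o y ≤ 2 * R}.ncard ≤ K) (x y : V) :
    ∑' o, (Measure.infinitePi fun _ : E => ρ)
        {ω | ∃ e ∈ G.nearEdges o R, e ∈ G.geodesicEdges r (φ ∘ ω) x y ∧ ω e ∈ A} ≤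
      K * ∫⁻ ω, ({e ∈ G.geodesicEdges r (φ ∘ ω) x y | ω e ∈ A}.encard : ℝ≥0∞)
        ∂(Measure.infinitePi fun _ : E => ρ) := by
  have := countable_edges hdeg hgrowth
  rw [lintegral_encard_geodesicEdges hφ hA]
  set f : E → ℝ≥0∞ := fun e => (Measure.infinitePi fun _ : E => ρ)
    {ω | e ∈ G.geodesicEdges r (φ ∘ ω) x y ∧ ω e ∈ A} with hf
  calc _ ≤ ∑' o, ∑' e, {o | e ∈ G.nearEdges o R}.indicator 1 o * f e := by
        refine ENNReal.tsum_le_tsum fun o => ?_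
        have hset : {ω : E → X | ∃ e ∈ G.nearEdges o R,
            e ∈ G.geodesicEdges r (φ ∘ ω) x y ∧ ω e ∈ A} = ⋃ e ∈ G.nearEdges o R,
              {ω | e ∈ G.geodesicEdges r (φ ∘ ω) x y ∧ ω e ∈ A} := by
          ext ω
          simp only [Set.mem_ofPred_eq, Set.mem_iUnion, exists_prop]
        rw [hset]
        refine (measure_biUnion_le _ (Set.to_countable _) _).trans ?_
        rw [tsum_subtype (G.nearEdges o R) f]
        refine ENNReal.tsum_le_tsum fun e => ?_
        by_cases he : e ∈ G.nearEdges o R <;> simp [he]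
    _ = ∑' e, (∑' o, {o | e ∈ G.nearEdges o R}.indicator 1 o) * f e := by
        rw [ENNReal.tsum_comm]
        exact tsum_congr fun e => ENNReal.tsum_mul_right
    _ ≤ ∑' e, K * f e := by
        refine ENNReal.tsum_le_tsum fun e => mul_le_mul_left ?_ _
        have h1 : ∑' o, {o | e ∈ G.nearEdges o R}.indicator (1 : V → ℝ≥0∞) o =
            ({o | e ∈ G.nearEdges o R}.encard : ℝ≥0∞) := by
          rw [← ENNReal.tsum_set_one, tsum_subtype _ (fun _ => (1 : ℝ≥0∞))]
          rfl
        rw [h1]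
        have := encard_setOf_mem_nearEdges_le hG hgrowth hK e
        exact_mod_cast ENat.toENNReal_le.2 this
    _ = K * ∑' e, f e := ENNReal.tsum_mul_left

open Classical in
/-- The expected number of good visits of the geodesic is proportional to the distance. -/
lemma le_tsum_measure_goodVisit (hG : G.Connected) (hdeg : G.BoundedDegree)
    (hgrowth : G.StrictPolynomialGrowth) (hφ : Measurable φ)
    (hgeod : ∀ x y, ∀ᵐ ω ∂(Measure.infinitePi fun _ : E => ρ),
      ∃ p : G.SelfAvoidingPath x y, G.IsTGeodesic (φ ∘ ω) p)
    (hr : ∀ x y : V, IsWellOrder (G.SelfAvoidingPath x y) (r x y))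
    {R K : ℕ} (hR : 0 < R) (hK : ∀ o, {y | G.dist o y ≤ 2 * R}.ncard ≤ K) {s : ℝ≥0} {q : ℝ≥0∞}
    (hq : ∀ o, (Measure.infinitePi fun _ : E => ρ) (G.FastCrossing φ o R s) ≤ q)
    (hqK : 16 * (K : ℝ≥0∞) ^ 2 * q ≤ 1) {x y : V} {m : ℕ}
    (hm : (2 * m + 1) * (2 * R) ≤ G.dist x y) :
    (m : ℝ≥0∞) * 2⁻¹ ≤
      ∑' o, (Measure.infinitePi fun _ : E => ρ) (G.GoodVisit φ r R s x y o) := by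
  have := countable_vertices hgrowth
  have := countable_edges hdeg hgrowth
  have hpeierls := measure_exists_chain_le (ρ := ρ) hG hgrowth hK
    (fun o => measurableSet_fastCrossing hφ o R s)
    (fun o => determinedBy_fastCrossing o R s) hq hqK (2 * m + 1) x
  set f : (E → X) → ℝ≥0∞ := fun ω => ∑' o, (G.GoodVisit φ r R s x y o).indicator 1 ω with hf
  have hfm : Measurable f := Measurable.tsum fun o =>
    measurable_one.indicator (measurableSet_goodVisit hφ R s x y o)
  have hint : ∫⁻ ω, f ω ∂(Measure.infinitePi fun _ : E => ρ) =
      ∑' o, (Measure.infinitePi fun _ : E => ρ) (G.GoodVisit φ r R s x y o) := by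
    rw [hf, lintegral_tsum fun o =>
      (measurable_one.indicator (measurableSet_goodVisit hφ R s x y o)).aemeasurable]
    exact tsum_congr fun o => lintegral_indicator_one (measurableSet_goodVisit hφ R s x y o)
  rw [← hint]
  refine le_trans (mul_le_mul_right ?_ _) (mul_meas_ge_le_lintegral hfm (m : ℝ≥0∞))
  have hcompl : (Measure.infinitePi fun _ : E => ρ) {ω | (m : ℝ≥0∞) ≤ f ω}ᶜ ≤ 2⁻¹ := by
    refine le_trans ?_ (hpeierls.trans (pow_le_of_le_one (by simp) (by simp) (by omega)))
    refine measure_mono_ae ?_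
    filter_upwards [hgeod x y] with ω hω hlt
    by_contra hcon
    refine hlt ?_
    obtain ⟨p, hp⟩ := exists_isLeastTGeodesic hr hω
    -- Zero costs: only the chain of visited vertices matters here.
    obtain ⟨l, hl, hl1, hl2, -⟩ := p.1.exists_chain hG (L := 2 * R) (by omega) (φ ∘ ω) 0 0
      (fun o => ω ∈ G.FastCrossing φ o R s) (by simp) (2 * m + 1) hm
    have hlen := length_of_mem_chains hl
    have hbad : 2 * l.countP (fun o => ω ∈ G.FastCrossing φ o R s) < 2 * m + 1 := by
      by_contra hbad
      exact hcon ⟨l, hl, hl1, not_lt.1 hbad⟩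
    -- The first chain vertex is `x`, too close to an endpoint for a good visit, and is dropped. At
    -- most `m` of the `2 * m` others are bad, so at least `m` are good.
    obtain ⟨z, l', -, -, rfl⟩ := hl
    obtain ⟨hxl, hl1'⟩ := List.pairwise_cons.1 hl1
    have hnodup : l'.Nodup := hl1'.imp fun {a b} hab h => by
      subst h
      rw [dist_self] at hab
      omega
    have hcount := List.length_eq_countP_add_countP
      (fun o => decide (ω ∈ G.FastCrossing φ o R s)) (l := l')
    rw [List.length_cons] at hlen
    rw [List.countP_cons] at hbad
    set t := (l'.filter (fun o => decide ¬ (decide (ω ∈ G.FastCrossing φ o R s) = true))).toFinset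
      with ht
    have hcard : m ≤ t.card := by
      rw [ht, List.toFinset_card_of_nodup (hnodup.filter _), ← List.countP_eq_length_filter]
      omega
    calc (m : ℝ≥0∞) ≤ t.card := by exact_mod_cast hcard
      _ = ∑ o ∈ t, (G.GoodVisit φ r R s x y o).indicator 1 ω := by
          rw [← nsmul_one, ← Finset.sum_const]
          refine Finset.sum_congr rfl fun o ho => ?_
          rw [ht, List.mem_toFinset, List.mem_filter] at ho
          symm
          refine Set.indicator_of_mem (s := G.GoodVisit φ r R s x y o) (f := 1)
            ⟨⟨p, hp, (hl2 o (List.mem_cons_of_mem _ ho.1)).1⟩, by simpa using ho.2, ?_, ?_⟩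
          · have := hxl o ho.1
            rw [dist_comm hG] at this
            omega
          · have := (hl2 o (List.mem_cons_of_mem _ ho.1)).2
            omega
      _ ≤ f ω := ENNReal.sum_le_tsum t
  have hadd := prob_add_prob_compl (μ := Measure.infinitePi fun _ : E => ρ)
    (measurableSet_le measurable_const hfm : MeasurableSet {ω | (m : ℝ≥0∞) ≤ f ω})
  have h1 : (2⁻¹ : ℝ≥0∞) + 2⁻¹ ≤
      (Measure.infinitePi fun _ : E => ρ) {ω | (m : ℝ≥0∞) ≤ f ω} + 2⁻¹ := by
    rw [ENNReal.inv_two_add_inv_two, ← hadd]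
    gcongr
  exact (ENNReal.add_le_add_iff_right (by simp)).1 h1

/-- With `θ = 2 ^ (-1 / L)`, rounding `R / L` down loses at most a factor 2. This puts the crossing
estimate into the form required for the second Peierls argument. -/
lemma exists_two_inv_pow_div_le {L : ℕ} (hL : 0 < L) :
    ∃ θ : ℝ, 0 < θ ∧ θ < 1 ∧ ∀ R : ℕ, (2⁻¹ : ℝ≥0∞) ^ (R / L) ≤ ENNReal.ofReal (2 * θ ^ R) := by
  set θ : ℝ := (2⁻¹ : ℝ) ^ ((L : ℝ)⁻¹) with hθ
  have hθ0 : 0 < θ := by positivity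
  have hθL : θ ^ L = 2⁻¹ := Real.rpow_inv_natCast_pow (by norm_num) hL.ne'
  have hθ1 : θ < 1 := Real.rpow_lt_one (by norm_num) (by norm_num) (by positivity)
  refine ⟨θ, hθ0, hθ1, fun R => ?_⟩
  have h1 : (2⁻¹ : ℝ) ≤ θ ^ (R % L) := by
    rw [← hθL]
    exact pow_le_pow_of_le_one hθ0.le hθ1.le (Nat.mod_lt R hL).le
  have h2 : (2⁻¹ : ℝ) ^ (R / L) ≤ 2 * θ ^ R := by
    rw [← Nat.div_add_mod R L, pow_add, pow_mul, hθL, Nat.div_add_mod R L]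
    have h3 : (0 : ℝ) < 2⁻¹ ^ (R / L) := by positivity
    nlinarith
  calc (2⁻¹ : ℝ≥0∞) ^ (R / L) = ENNReal.ofReal (2⁻¹ ^ (R / L)) := by
        rw [ENNReal.ofReal_pow (by norm_num), ENNReal.ofReal_inv_of_pos (by norm_num)]
        norm_num
    _ ≤ _ := ENNReal.ofReal_le_ofReal h2

/-- The geodesic uses edges with mark in a given set of positive probability with positive
density. -/
theorem ExponentialSubcritical.exists_mul_dist_le_lintegral_encard (hG : G.Connected)
    (hdeg : G.BoundedDegree) (hgrowth : G.StrictPolynomialGrowth) (hφ : Measurable φ)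
    (hmean : HasFiniteMean (ρ.map φ)) (hsub : G.ExponentialSubcritical (ρ.map φ))
    (hr : ∀ x y : V, IsWellOrder (G.SelfAvoidingPath x y) (r x y))
    {A : Set X} (hA : MeasurableSet A) (hA0 : 0 < ρ A) :
    ∃ c : ℝ≥0, 0 < c ∧ ∀ᶠ z in G.distAtTop, c * (G.dist z.1 z.2 : ℝ≥0∞) ≤
      ∫⁻ ω, ({e ∈ G.geodesicEdges r (φ ∘ ω) z.1 z.2 | ω e ∈ A}.encard : ℝ≥0∞)
        ∂(Measure.infinitePi fun _ : E => ρ) := by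
  have hprob : IsProbabilityMeasure (ρ.map φ) := Measure.isProbabilityMeasure_map hφ.aemeasurable
  have hgeod := hsub.ae_exists_isTGeodesic hG hdeg hgrowth hφ hmean
  obtain ⟨δ, L, R₀, hδ, hL, hfast⟩ := hsub.exists_fastCrossing_decay hG hdeg hgrowth hφ
  obtain ⟨θ, hθ0, hθ1, hθ⟩ := exists_two_inv_pow_div_le hL
  set a := sInf (ρ.map φ).support
  -- Truncation bounds the cost of the edges leading to the sphere; `R` is then taken so large that
  -- the gain `R δ / 2` inside the ball exceeds `M`.
  obtain ⟨M, hM⟩ : ∃ M : ℕ, 0 < ρ (A ∩ φ ⁻¹' Iic (M : ℝ≥0)) := by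
    by_contra! hcon
    refine hA0.ne' (measure_mono_null (fun t ht => ?_)
      (measure_iUnion_null fun M : ℕ => le_antisymm (hcon M) zero_le))
    obtain ⟨M, hM⟩ := exists_nat_ge (φ t)
    exact Set.mem_iUnion.2 ⟨M, ht, hM⟩
  have hlow : 0 < ρ (φ ⁻¹' Iic (a + δ / 2)) := by
    rw [← Measure.map_apply hφ measurableSet_Iic]
    exact measure_Iic_sInf_support_add_pos _ (by positivity)
  have hMR : ∀ᶠ R : ℕ in atTop, (M : ℝ≥0) < R * (δ / 2) :=
    (tendsto_natCast_atTop_atTop.atTop_mul_const (by positivity)).eventually_gt_atTop _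
  obtain ⟨R, ⟨K, hK, hKq⟩, hRM, hRR₀, hR⟩ :=
    ((eventually_exists_peierls_bound hgrowth hθ0 hθ1 2 (by norm_num)).and
      (hMR.and ((eventually_ge_atTop R₀).and (eventually_gt_atTop 0)))).exists
  obtain ⟨k, hk⟩ := exists_ncard_nearEdges_le hdeg hgrowth R
  set A' := A ∩ φ ⁻¹' Iic (M : ℝ≥0) with hA'
  have hA'm : MeasurableSet A' := hA.inter (hφ measurableSet_Iic)
  have hs : (R : ℝ≥0) * (a + δ / 2) + M < R * (a + δ) := by
    calc (R : ℝ≥0) * (a + δ / 2) + M < R * (a + δ / 2) + R * (δ / 2) := by gcongr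
      _ = R * (a + δ) := by rw [← mul_add, add_assoc, add_halves]
  set κ := (min (ρ A') (ρ (φ ⁻¹' Iic (a + δ / 2)))) ^ k with hκ
  have hκ0 : 0 < κ := ENNReal.pow_pos (lt_min hM hlow) _
  obtain ⟨c, hc0, hc⟩ := ENNReal.lt_iff_exists_nnreal_btwn.1
    (ENNReal.div_pos hκ0.ne' (b := (32 * R * K : ℕ)) (ENNReal.natCast_ne_top _))
  refine ⟨c, by exact_mod_cast hc0, ?_⟩
  have hev : ∀ᶠ z in G.distAtTop, 8 * R ≤ G.dist z.1 z.2 :=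
    tendsto_comap.eventually (eventually_ge_atTop (8 * R))
  filter_upwards [hev] with z hz
  obtain ⟨x, y⟩ := z
  dsimp only at hz ⊢
  set n := G.dist x y with hn
  set J := ∫⁻ ω, ({e ∈ G.geodesicEdges r (φ ∘ ω) x y | ω e ∈ A}.encard : ℝ≥0∞)
        ∂(Measure.infinitePi fun _ : E => ρ) with hJ
  -- Combined with `m / 2 * κ ≤ K * J`, the bound `n ≤ 16 * R * m` yields the constant `κ / (32 * R
  -- * K)`.
  obtain ⟨m, hm1, hm2⟩ : ∃ m : ℕ, (2 * m + 1) * (2 * R) ≤ n ∧ n ≤ 16 * R * m := by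
    have h1 : n / (2 * R) * (2 * R) ≤ n := Nat.div_mul_le_self _ _
    have h2 : n < (n / (2 * R) + 1) * (2 * R) :=
      Nat.lt_mul_of_div_lt (Nat.lt_succ_self _) (by omega)
    have h4 : 4 ≤ n / (2 * R) := (Nat.le_div_iff_mul_le (by omega)).2 (by omega)
    set N := n / (2 * R)
    refine ⟨(N - 1) / 2, le_trans (Nat.mul_le_mul_right _ (by omega)) h1, h2.le.trans ?_⟩
    have h5 : N + 1 ≤ 8 * ((N - 1) / 2) := by omega
    calc (N + 1) * (2 * R) ≤ 8 * ((N - 1) / 2) * (2 * R) := Nat.mul_le_mul_right _ h5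
      _ = _ := by ring
  have hlower := le_tsum_measure_goodVisit hG hdeg hgrowth hφ hgeod hr hR hK
    (fun o => (hfast R hRR₀ o).trans (hθ R)) hKq (x := x) (y := y) hm1
  have hmid : (∑' o, (Measure.infinitePi fun _ : E => ρ)
      (G.GoodVisit φ r R (R * (a + δ)) x y o)) * κ ≤ K * J := by
    rw [← ENNReal.tsum_mul_right]
    refine (ENNReal.tsum_le_tsum fun o => measure_goodVisit_mul_le hG hdeg hgrowth hφ hgeod hr
      hA'm (fun t ht => ht.2) hR hs hk x y o).trans ?_
    refine (tsum_measure_exists_mem_nearEdges_le hG hdeg hgrowth hφ hA'm hK x y).trans ?_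
    refine mul_le_mul_right (lintegral_mono fun ω => ?_) _
    refine ENat.toENNReal_le.2 (Set.encard_le_encard ?_)
    exact fun e he => ⟨he.1, he.2.1⟩
  calc (c : ℝ≥0∞) * n ≤ κ / (32 * R * K : ℕ) * n := mul_le_mul_left hc.le _
    _ = n * κ / (32 * R * K : ℕ) := by rw [mul_comm, mul_div_assoc]
    _ ≤ J := by
        refine ENNReal.div_le_of_le_mul ?_
        calc (n : ℝ≥0∞) * κ ≤ (16 * R * m : ℕ) * κ := by gcongr
          _ = 32 * R * ((m * 2⁻¹) * κ) := by
              have h2 : (32 : ℝ≥0∞) * 2⁻¹ = 16 := by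
                rw [show (32 : ℝ≥0∞) = 16 * 2 by norm_num, mul_assoc,
                  ENNReal.mul_inv_cancel (by simp) (by simp), mul_one]
              push_cast
              rw [← h2]
              ring
          _ ≤ 32 * R * ((∑' o, (Measure.infinitePi fun _ : E => ρ)
                (G.GoodVisit φ r R (R * (a + δ)) x y o)) * κ) := by gcongr
          _ ≤ 32 * R * (K * J) := by gcongr
          _ = J * (32 * R * K : ℕ) := by push_cast; ring

end Counting

/-! ### Coupled weights and the two conclusions -/

section Coupling

lemma Walk.time_add_countP_mul_le {x y : V} (p : G.Walk x y) {w w' : E → ℝ≥0} {η : ℝ≥0}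
    {P : E → Prop} [DecidablePred P] (hle : ∀ e, w' e ≤ w e) (hP : ∀ e, P e → w' e + η ≤ w e) :
    p.time w' + η * p.edges.countP (fun e => P e) ≤ p.time w := by
  induction p with
  | nil => simp
  | cons e h p ih =>
    rw [time_cons, time_cons, edges_cons, List.countP_cons]
    by_cases he : P e
    · simp only [he, decide_true, if_true, Nat.cast_add, Nat.cast_one]
      calc _ = (w' e + η) + (p.time w' + η * p.edges.countP (fun e => P e)) := by ring
        _ ≤ _ := add_le_add (hP e he) ih
    · simp only [he, decide_false, Bool.false_eq_true, if_false, add_zero]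
      calc _ = w' e + (p.time w' + η * p.edges.countP (fun e => P e)) := by ring
        _ ≤ _ := add_le_add (hle e) ih

variable {X : Type*} [MeasurableSpace X] {ρ : Measure X} [IsProbabilityMeasure ρ] {φ : X → ℝ≥0}

lemma lintegral_passageTime_ne_top (hG : G.Connected) (hφ : Measurable φ)
    (hmean : HasFiniteMean (ρ.map φ)) (x y : V) :
    ∫⁻ ω, (G.passageTime (φ ∘ ω) x y : ℝ≥0∞) ∂(Measure.infinitePi fun _ : E => ρ) ≠ ∞ := by
  obtain ⟨p⟩ := hG x y
  refine ne_top_of_le_ne_top ?_ (lintegral_mono fun ω =>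
    ENNReal.coe_le_coe.2 (passageTime_le (φ ∘ ω) p))
  rw [lintegral_time hφ]
  exact ENNReal.mul_ne_top (by simp) hmean.ne

lemma expectedTime_map [Countable E] (hφ : Measurable φ) [IsProbabilityMeasure (ρ.map φ)]
    (x y : V) : G.expectedTime (ρ.map φ) x y =
      (∫⁻ ω, (G.passageTime (φ ∘ ω) x y : ℝ≥0∞) ∂(Measure.infinitePi fun _ : E => ρ)).toReal := by
  have hm : Measurable fun w : E → ℝ≥0 => G.passageTime w x y :=
    measurable_passageTime (fun e => measurable_pi_apply e) x y
  have hmap : weightLaw E (ρ.map φ) =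
      (Measure.infinitePi fun _ : E => ρ).map (fun ω e => φ (ω e)) := by
    rw [Measure.infinitePi_map_pi (fun _ => ρ) (fun _ => hφ)]
    rfl
  rw [expectedTime, integral_eq_lintegral_of_nonneg_ae (ae_of_all _ fun _ => NNReal.coe_nonneg _)
    hm.coe_nnreal_real.aestronglyMeasurable]
  simp only [ENNReal.ofReal_coe_nnreal]
  rw [hmap, lintegral_map hm.coe_nnreal_ennreal (by fun_prop)]
  rfl

/-- If every gap `η = 1 / (n + 1)` had probability zero, the two coordinates would agree almost
everywhere and the marginals would coincide. -/
lemma exists_pos_measure_add_le {ρ : Measure (ℝ≥0 × ℝ≥0)}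
    (hne : ρ.map Prod.fst ≠ ρ.map Prod.snd) (hle : ∀ᵐ z ∂ρ, z.1 ≤ z.2) :
    ∃ η : ℝ≥0, 0 < η ∧ 0 < ρ {z | z.1 + η ≤ z.2} := by
  by_contra! hcon
  refine hne (Measure.map_congr ?_)
  have h1 : ∀ᵐ z ∂ρ, ∀ n : ℕ, ¬ z.1 + 1 / ((n : ℝ≥0) + 1) ≤ z.2 := by
    rw [ae_all_iff]
    intro n
    have := le_antisymm (hcon (1 / ((n : ℝ≥0) + 1)) (by positivity)) zero_le
    rw [ae_iff]
    simpa using this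
  filter_upwards [hle, h1] with z hz hz'
  refine le_antisymm hz ?_
  have hlim : Tendsto (fun n : ℕ => z.1 + 1 / ((n : ℝ≥0) + 1)) atTop (nhds (z.1 + 0)) :=
    tendsto_const_nhds.add tendsto_one_div_add_atTop_nhds_zero_nat
  rw [add_zero] at hlim
  exact ge_of_tendsto' hlim fun n => (not_le.1 (hz' n)).le

end Coupling

lemma eventually_dist_pos : ∀ᶠ z in G.distAtTop, 0 < G.dist z.1 z.2 :=
  tendsto_comap.eventually (eventually_gt_atTop 0)

theorem ExponentialSubcritical.absContExpectedEmpirical (hG : G.Connected)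
    (hdeg : G.BoundedDegree) (hgrowth : G.StrictPolynomialGrowth) {ν : Measure ℝ≥0}
    [IsProbabilityMeasure ν] (hmean : HasFiniteMean ν) (hsub : G.ExponentialSubcritical ν)
    {r : ∀ x y : V, G.SelfAvoidingPath x y → G.SelfAvoidingPath x y → Prop}
    (hr : ∀ x y : V, IsWellOrder (G.SelfAvoidingPath x y) (r x y)) :
    G.AbsContExpectedEmpirical r ν := by
  intro A hA hA0
  have hmap : ν.map id = ν := Measure.map_id
  obtain ⟨c, hc, hev⟩ := ExponentialSubcritical.exists_mul_dist_le_lintegral_encard (ρ := ν)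
    hG hdeg hgrowth measurable_id (by rwa [hmap]) (by rwa [hmap]) hr hA hA0
  refine lt_of_lt_of_le (ENNReal.coe_pos.2 hc) (le_liminf_of_le (by isBoundedDefault) ?_)
  filter_upwards [hev, eventually_dist_pos] with z hz hz0
  rw [ENNReal.le_div_iff_mul_le (Or.inl (by exact_mod_cast hz0.ne'))
    (Or.inl (ENNReal.natCast_ne_top _))]
  exact hz

theorem ExponentialSubcritical.expectedTimeMuchLess (hG : G.Connected)
    (hdeg : G.BoundedDegree) (hgrowth : G.StrictPolynomialGrowth) {ν ν' : Measure ℝ≥0}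
    [IsProbabilityMeasure ν] [IsProbabilityMeasure ν'] (hmean : HasFiniteMean ν)
    (hmean' : HasFiniteMean ν') (hsub : G.ExponentialSubcritical ν)
    (hdom : StrictlyStochasticallyDominates ν ν') : G.ExpectedTimeMuchLess ν' ν := by
  classical
  have := countable_edges hdeg hgrowth
  obtain ⟨hne, ρ, rfl, rfl, hle⟩ := hdom
  have hρ : IsProbabilityMeasure ρ :=
    ⟨by rw [← Set.preimage_univ (f := Prod.fst), ← Measure.map_apply measurable_fst .univ,
      measure_univ]⟩
  obtain ⟨η, hη, hpos⟩ := exists_pos_measure_add_le hne hle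
  set A : Set (ℝ≥0 × ℝ≥0) := {z | z.1 + η ≤ z.2} with hAdef
  have hA : MeasurableSet A := measurableSet_le (by fun_prop) (by fun_prop)
  -- The conclusion does not involve tie-breaking, so any well-ordering will do.
  set r : ∀ x y : V, G.SelfAvoidingPath x y → G.SelfAvoidingPath x y → Prop :=
    fun x y => WellOrderingRel
  have hr : ∀ x y : V, IsWellOrder (G.SelfAvoidingPath x y) (r x y) := fun x y =>
    WellOrderingRel.isWellOrder
  obtain ⟨c, hc, hev⟩ := ExponentialSubcritical.exists_mul_dist_le_lintegral_encard
    hG hdeg hgrowth measurable_snd hmean hsub hr hA hpos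
  have hle' : ∀ᵐ ω ∂(Measure.infinitePi fun _ : E => ρ), ∀ e, (ω e).1 ≤ (ω e).2 := by
    rw [ae_all_iff]
    exact fun e => (measurePreserving_eval_infinitePi
      (fun _ : E => ρ) e).quasiMeasurePreserving.ae hle
  -- The geodesic of the larger weights is a competitor for the smaller ones, where each of its
  -- edges with mark in `A` is cheaper by at least `η`.
  have hgap : ∀ x y : V,
      ∫⁻ ω, (G.passageTime (Prod.fst ∘ ω) x y : ℝ≥0∞) ∂(Measure.infinitePi fun _ : E => ρ) +
        η * ∫⁻ ω, ({e ∈ G.geodesicEdges r (Prod.snd ∘ ω) x y | ω e ∈ A}.encard : ℝ≥0∞)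
          ∂(Measure.infinitePi fun _ : E => ρ) ≤
      ∫⁻ ω, (G.passageTime (Prod.snd ∘ ω) x y : ℝ≥0∞)
        ∂(Measure.infinitePi fun _ : E => ρ) := by
    intro x y
    have hm : Measurable fun ω : E → ℝ≥0 × ℝ≥0 =>
        (G.passageTime (Prod.fst ∘ ω) x y : ℝ≥0∞) :=
      (measurable_passageTime (fun e => measurable_fst.comp (measurable_pi_apply e))
        x y).coe_nnreal_ennreal
    rw [← lintegral_const_mul' _ _ ENNReal.coe_ne_top, ← lintegral_add_left hm]
    refine lintegral_mono_ae ?_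
    filter_upwards [hle', hsub.ae_exists_isTGeodesic hG hdeg hgrowth measurable_snd hmean x y]
      with ω hω hgeod
    obtain ⟨p, hp⟩ := exists_isLeastTGeodesic hr hgeod
    have h1 := p.1.time_add_countP_mul_le (w := Prod.snd ∘ ω) (w' := Prod.fst ∘ ω) (η := η)
      (P := fun e => ω e ∈ A) hω fun e he => he
    have h2 : {e ∈ G.geodesicEdges r (Prod.snd ∘ ω) x y | ω e ∈ A}.encard ≤
        (p.1.edges.countP (fun e => ω e ∈ A) : ℕ) := by
      have : {e ∈ G.geodesicEdges r (Prod.snd ∘ ω) x y | ω e ∈ A} =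
          ((p.1.edges.filter (fun e => ω e ∈ A)).toFinset : Set E) := by
        ext e
        simp [hp.geodesicEdges_eq hr]
      rw [this, Set.encard_coe_eq_coe_finsetCard, List.countP_eq_length_filter]
      exact_mod_cast List.toFinset_card_le _
    have h3 : ({e ∈ G.geodesicEdges r (Prod.snd ∘ ω) x y | ω e ∈ A}.encard : ℝ≥0∞) ≤
        ((p.1.edges.countP (fun e => ω e ∈ A) : ℝ≥0) : ℝ≥0∞) := by
      exact (ENat.toENNReal_le.2 h2).trans (le_of_eq (by simp))
    rw [← hp.1]
    calc _ ≤ (p.1.time (Prod.fst ∘ ω) : ℝ≥0∞) +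
          η * ((p.1.edges.countP (fun e => ω e ∈ A) : ℝ≥0) : ℝ≥0∞) := by
          gcongr
          exact passageTime_le _ _
      _ ≤ _ := by exact_mod_cast h1
  refine lt_of_lt_of_le (b := (((η * c : ℝ≥0) : ℝ) : EReal)) ?_
    (le_liminf_of_le (by isBoundedDefault) ?_)
  · have : (0 : ℝ) < (η * c : ℝ≥0) := by positivity
    exact_mod_cast this
  filter_upwards [hev, eventually_dist_pos] with z hz hz0
  rw [EReal.coe_le_coe_iff, le_div_iff₀ (by exact_mod_cast hz0),
    expectedTime_map measurable_fst, expectedTime_map measurable_snd, le_sub_iff_add_le']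
  have hfin := lintegral_passageTime_ne_top hG measurable_snd hmean z.1 z.2
  have hfin' := lintegral_passageTime_ne_top hG measurable_fst hmean' z.1 z.2
  have h1 : ∫⁻ ω, (G.passageTime (Prod.fst ∘ ω) z.1 z.2 : ℝ≥0∞)
      ∂(Measure.infinitePi fun _ : E => ρ) + ((η * c * G.dist z.1 z.2 : ℝ≥0) : ℝ≥0∞) ≤
      ∫⁻ ω, (G.passageTime (Prod.snd ∘ ω) z.1 z.2 : ℝ≥0∞)
        ∂(Measure.infinitePi fun _ : E => ρ) := by
    refine le_trans (add_le_add le_rfl ?_) (hgap z.1 z.2)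
    rw [mul_assoc, ENNReal.coe_mul]
    gcongr
    exact_mod_cast hz
  have h2 := ENNReal.toReal_mono hfin h1
  rw [ENNReal.toReal_add hfin' ENNReal.coe_ne_top] at h2
  exact_mod_cast h2

end Multigraph

theorem theorem6 {V E : Type*} [Infinite V] (G : Multigraph V E)
    (hconn : G.Connected) (hdeg : G.BoundedDegree) (hgrowth : G.StrictPolynomialGrowth)
    (ν : Measure ℝ≥0) [IsProbabilityMeasure ν]
    (hmean : HasFiniteMean ν) (hsub : G.ExponentialSubcritical ν) :
    (∀ r : ∀ x y : V, G.SelfAvoidingPath x y → G.SelfAvoidingPath x y → Prop,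
      (∀ x y : V, IsWellOrder (G.SelfAvoidingPath x y) (r x y)) →
        G.AbsContExpectedEmpirical r ν) ∧
    (∀ (ν' : Measure ℝ≥0) [IsProbabilityMeasure ν'], HasFiniteMean ν' →
      StrictlyStochasticallyDominates ν ν' → G.ExpectedTimeMuchLess ν' ν) :=
  ⟨fun _ hr => hsub.absContExpectedEmpirical hconn hdeg hgrowth hmean hr,
    fun _ _ hmean' hdom => hsub.expectedTimeMuchLess hconn hdeg hgrowth hmean hmean' hdom⟩
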